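/- Consider a model $\mathcal M$ of extensional dependent type theory: a category with families over an arbitrary category $\mathcal C$ of contexts (types and terms with strictly functorial substitution, an empty context $1$, context extension $\Gamma.A$), with dependent products and sums ($\beta$ and $\eta$), extensional equality types (equality reflection and uniqueness of equality proofs), empty, unit and boolean types, and $W$-types with dependent elimination, everything strictly stable under substitution. A \emph{strictly cumulative hierarchy} in $\mathcal M$ consists of closed types $U_0,U_1,U_2,\dots$ with decoding families $A:U_i\vdash \mathrm{El}_i(A)$ and coercions $\uparrow_i^j:U_i\to U_j$ for $i\le j$, such that: each $U_i$ has codes for $\Pi$-, $\Sigma$-, $W$- and equality types (of codes and families of codes), for the empty, unit and boolean types, and for each $U_k$ with $k<i$; all of this is stable under substitution; $\mathrm{El}_i$ sends each code, up to strict equality, to the type it stands for; and the coercions are functorial ($\uparrow_i^i=\mathrm{id}$, $\uparrow_j^k\uparrow_i^j=\uparrow_i^k$), satisfy $\mathrm{El}_j(\uparrow_i^j A)=\mathrm{El}_i(A)$, and commute strictly with all codes. Its $i$-th \emph{generic family} is the projection $1.(A:U_i).\mathrm{El}_i(A)\to 1.U_i$, and $U_i$ is \emph{generic for} the class of those morphisms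 of $\mathcal C$ that are pullbacks of this projection. \textbf{Theorem.} Let $U$ be a strictly cumulative hierarchy in $\mathcal M$. Then there is a strictly cumulative hierarchy $V$ in the same model $\mathcal M$ such that: 1. the codes of $V$ are injective: for every $i$ and in every context, each of the code-forming operations of $V_i$ for $\Pi$-, $\Sigma$-, $W$- and equality types is injective in all its arguments jointly, e.g. $\mathsf{pi}(A,B)=\mathsf{pi}(A',B')$ implies $A=A'$ and $B=B'$; 2. for every $i$, $V_i$ is generic for the same class of morphisms of $\mathcal C$ as $U_i$; moreover a type $A$ in a context $\Gamma$ is strictly equal to the decoding of some term of $V_i$ in context $\Gamma$ if and only if it is strictly equal to the decoding of some term of $U_i$ in context $\Gamma$; 3. there are functions $\mathsf{Up}_i:U_i\to V_i$ and $\mathsf{Dec}_i:V_i\to U_i$, stable under substitution, with $\mathsf{Dec}_i\circ\mathsf{Up}_i=\mathrm{id}$ and $\mathrm{El}^V_i(A)=\mathrm{El}^U_i(\mathsf{Dec}_i(A))$, both commuting with the coercions, where $\mathsf{Dec}_i$ sends the codes of $V_i$ for $\Pi$-, $\Sigma$-, $W$-, equality, empty, unit and boolean types to the corresponding codes of $U_i$.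 -/

import Mathlib

open CategoryTheory

universe u v w w'

/-- A model of dependent type theory without type formers (a category with families, presented as a
natural model): contexts and substitutions form the category `C`; `Ty Γ` and `Tm Γ` are the types
and the terms in context `Γ`, every term `t` having the type `tp t`; types and terms are acted on
strictly functorially by substitutions; there is an empty context, and every context can be
extended by a type. -/
structure NatModel (C : Type u) [Category.{v} C] where
  Ty : C → Type w
  Tm : C → Type w'
  tp {Γ : C} : Tm Γ → Ty Γ
  tySub {Γ Δ : C} (σ : Δ ⟶ Γ) : Ty Γ → Ty Δ
  tmSub {Γ Δ : C} (σ : Δ ⟶ Γ) : Tm Γ → Tm Δ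
  tySub_id {Γ : C} (A : Ty Γ) : tySub (𝟙 Γ) A = A
  tySub_comp {Γ Δ Θ : C} (τ : Θ ⟶ Δ) (σ : Δ ⟶ Γ) (A : Ty Γ) :
    tySub (τ ≫ σ) A = tySub τ (tySub σ A)
  tmSub_id {Γ : C} (t : Tm Γ) : tmSub (𝟙 Γ) t = t
  tmSub_comp {Γ Δ Θ : C} (τ : Θ ⟶ Δ) (σ : Δ ⟶ Γ) (t : Tm Γ) :
    tmSub (τ ≫ σ) t = tmSub τ (tmSub σ t)
  tp_tmSub {Γ Δ : C} (σ : Δ ⟶ Γ) (t : Tm Γ) : tp (tmSub σ t) = tySub σ (tp t)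
  /-- the empty context -/
  nil : C
  nilTerminal : Limits.IsTerminal nil
  /-- context extension `Γ.A` -/
  ext (Γ : C) (A : Ty Γ) : C
  /-- the weakening substitution `Γ.A ⟶ Γ` -/
  wk {Γ : C} (A : Ty Γ) : ext Γ A ⟶ Γ
  /-- the last variable of `Γ.A` -/
  var {Γ : C} (A : Ty Γ) : Tm (ext Γ A)
  tp_var {Γ : C} (A : Ty Γ) : tp (var A) = tySub (wk A) A
  /-- the extended substitution `⟨σ, a⟩ : Δ ⟶ Γ.A` -/
  cons {Γ Δ : C} (σ : Δ ⟶ Γ) (A : Ty Γ) (a : Tm Δ) (h : tp a = tySub σ A) : Δ ⟶ ext Γ A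
  cons_wk {Γ Δ : C} (σ : Δ ⟶ Γ) (A : Ty Γ) (a : Tm Δ) (h : tp a = tySub σ A) :
    cons σ A a h ≫ wk A = σ
  var_cons {Γ Δ : C} (σ : Δ ⟶ Γ) (A : Ty Γ) (a : Tm Δ) (h : tp a = tySub σ A) :
    tmSub (cons σ A a h) (var A) = a
  cons_eta {Γ Δ : C} (A : Ty Γ) (τ : Δ ⟶ ext Γ A)
    (h : tp (tmSub τ (var A)) = tySub (τ ≫ wk A) A) :
    cons (τ ≫ wk A) A (tmSub τ (var A)) h = τ

namespace NatModel

variable {C : Type u} [Category.{v} C] (M : NatModel.{u, v, w, w'} C)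

/-- The terms `Γ ⊢ t : A`. -/
def Term {Γ : C} (A : M.Ty Γ) : Type w' := {t : M.Tm Γ // M.tp t = A}

/-- Substitution on typed terms; the type `A'` of the result may be any type equal to `A[σ]`. -/
def sub {Γ Δ : C} (σ : Δ ⟶ Γ) {A : M.Ty Γ} {A' : M.Ty Δ} (h : M.tySub σ A = A')
    (t : M.Term A) : M.Term A' :=
  ⟨M.tmSub σ t.1, by rw [M.tp_tmSub, t.2, h]⟩

/-- A term of type `A` regarded as a term of the equal type `A'`. -/
def castTm {Γ : C} {A A' : M.Ty Γ} (h : A = A') (t : M.Term A) : M.Term A' :=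
  ⟨t.1, t.2.trans h⟩

/-- The substitution `⟨id, a⟩ : Γ ⟶ Γ.A`. -/
def inst {Γ : C} {A : M.Ty Γ} (a : M.Term A) : Γ ⟶ M.ext Γ A :=
  M.cons (𝟙 Γ) A a.1 (by rw [a.2, M.tySub_id])

/-- The substitution `σ.A : Δ.A' ⟶ Γ.A` under a variable, where `A' = A[σ]`. -/
def lift {Γ Δ : C} (σ : Δ ⟶ Γ) {A : M.Ty Γ} {A' : M.Ty Δ} (h : M.tySub σ A = A') :
    M.ext Δ A' ⟶ M.ext Γ A :=
  M.cons (M.wk A' ≫ σ) A (M.var A') (by rw [M.tp_var, M.tySub_comp, h])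

/-- The identity substitution `Γ.A' ⟶ Γ.A` for equal types `A` and `A'`. -/
def castCtx {Γ : C} {A A' : M.Ty Γ} (h : A = A') : M.ext Γ A' ⟶ M.ext Γ A :=
  M.lift (𝟙 Γ) ((M.tySub_id A).trans h)

theorem hom_ext {Γ Δ : C} {A : M.Ty Γ} {τ τ' : Δ ⟶ M.ext Γ A}
    (h₁ : τ ≫ M.wk A = τ' ≫ M.wk A) (h₂ : M.tmSub τ (M.var A) = M.tmSub τ' (M.var A)) :
    τ = τ' := by
  have e : ∀ ρ : Δ ⟶ M.ext Γ A, M.tp (M.tmSub ρ (M.var A)) = M.tySub (ρ ≫ M.wk A) A := by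
    intro ρ
    rw [M.tp_tmSub, M.tp_var, M.tySub_comp]
  rw [← M.cons_eta A τ (e τ), ← M.cons_eta A τ' (e τ')]
  congr 1

theorem comp_cons {Γ Δ Θ : C} (τ : Θ ⟶ Δ) (σ : Δ ⟶ Γ) (A : M.Ty Γ) (a : M.Tm Δ)
    (h : M.tp a = M.tySub σ A) :
    τ ≫ M.cons σ A a h = M.cons (τ ≫ σ) A (M.tmSub τ a)
      (by rw [M.tp_tmSub, h, M.tySub_comp]) := by
  apply M.hom_ext
  · rw [Category.assoc, M.cons_wk, M.cons_wk]
  · rw [M.tmSub_comp, M.var_cons, M.var_cons]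

theorem lift_wk {Γ Δ : C} (σ : Δ ⟶ Γ) {A : M.Ty Γ} {A' : M.Ty Δ} (h : M.tySub σ A = A') :
    M.lift σ h ≫ M.wk A = M.wk A' ≫ σ :=
  M.cons_wk _ _ _ _

theorem cons_lift {Γ Δ Θ : C} (τ : Θ ⟶ Δ) (σ : Δ ⟶ Γ) {A : M.Ty Γ} {A' : M.Ty Δ}
    (h : M.tySub σ A = A') (a : M.Tm Θ) (ha : M.tp a = M.tySub τ A') :
    M.cons τ A' a ha ≫ M.lift σ h =
      M.cons (τ ≫ σ) A a (by rw [ha, ← h, M.tySub_comp]) := by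
  apply M.hom_ext
  · rw [Category.assoc, M.lift_wk, ← Category.assoc, M.cons_wk, M.cons_wk]
  · rw [M.tmSub_comp, lift, M.var_cons, M.var_cons, M.var_cons]

theorem inst_comp {Γ Δ : C} (σ : Δ ⟶ Γ) {A : M.Ty Γ} {A' : M.Ty Δ} (h : M.tySub σ A = A')
    (a : M.Term A) : σ ≫ M.inst a = M.inst (M.sub σ h a) ≫ M.lift σ h := by
  apply M.hom_ext
  · simp only [inst, Category.assoc, lift_wk, cons_wk, Category.comp_id]
    rw [← Category.assoc, M.cons_wk, Category.id_comp]
  · rw [M.tmSub_comp, M.tmSub_comp, inst, lift, inst, M.var_cons, M.var_cons, M.var_cons, sub]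

/-- `B[a][σ] = B[σ.A][a[σ]]`. -/
theorem tySub_inst {Γ Δ : C} (σ : Δ ⟶ Γ) {A : M.Ty Γ} (B : M.Ty (M.ext Γ A)) (a : M.Term A) :
    M.tySub σ (M.tySub (M.inst a) B) =
      M.tySub (M.inst (M.sub σ rfl a)) (M.tySub (M.lift σ rfl) B) := by
  rw [← M.tySub_comp, ← M.tySub_comp, ← M.inst_comp]

/-- `B[σ.A][a][τ] = B[(σ ∘ τ).A][a[τ]]`. -/
theorem tySub_lift_inst {Γ Δ Θ : C} (τ : Θ ⟶ Δ) (σ : Δ ⟶ Γ) {A : M.Ty Γ}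
    (B : M.Ty (M.ext Γ A)) (a : M.Term (M.tySub σ A)) :
    M.tySub τ (M.tySub (M.inst a) (M.tySub (M.lift σ rfl) B)) =
      M.tySub (M.inst (M.sub τ (M.tySub_comp τ σ A).symm a))
        (M.tySub (M.lift (τ ≫ σ) rfl) B) := by
  simp only [← M.tySub_comp]
  congr 1
  rw [inst, inst, M.cons_lift, M.cons_lift, M.comp_cons]
  apply M.hom_ext
  · simp only [cons_wk, Category.id_comp]
  · simp only [var_cons, sub]

/-- `D[wk][τ.E] = D[τ][wk]`. -/
theorem tySub_wk_lift {Γ Δ : C} (τ : Δ ⟶ Γ) {E : M.Ty Γ} {E' : M.Ty Δ}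
    (h : M.tySub τ E = E') {D : M.Ty Γ} {D' : M.Ty Δ} (hD : M.tySub τ D = D') :
    M.tySub (M.lift τ h) (M.tySub (M.wk E) D) = M.tySub (M.wk E') D' := by
  rw [← M.tySub_comp, M.lift_wk, M.tySub_comp, hD]

/-- Dependent products. Application, with its `β` and `η` laws, is the inverse of abstraction. -/
structure PiTypes where
  Pi {Γ : C} (A : M.Ty Γ) (B : M.Ty (M.ext Γ A)) : M.Ty Γ
  Pi_sub {Γ Δ : C} (σ : Δ ⟶ Γ) (A : M.Ty Γ) (B : M.Ty (M.ext Γ A)) :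
    M.tySub σ (Pi A B) = Pi (M.tySub σ A) (M.tySub (M.lift σ rfl) B)
  lam {Γ : C} {A : M.Ty Γ} {B : M.Ty (M.ext Γ A)} (b : M.Term B) : M.Term (Pi A B)
  lam_sub {Γ Δ : C} (σ : Δ ⟶ Γ) {A : M.Ty Γ} {B : M.Ty (M.ext Γ A)} (b : M.Term B) :
    M.sub σ (Pi_sub σ A B) (lam b) = lam (M.sub (M.lift σ rfl) rfl b)
  lam_bijective {Γ : C} (A : M.Ty Γ) (B : M.Ty (M.ext Γ A)) :
    Function.Bijective (lam : M.Term B → M.Term (Pi A B))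

/-- Dependent sums. The projections, with their `β` and `η` laws, are the inverse of pairing. -/
structure SigmaTypes where
  Sig {Γ : C} (A : M.Ty Γ) (B : M.Ty (M.ext Γ A)) : M.Ty Γ
  Sig_sub {Γ Δ : C} (σ : Δ ⟶ Γ) (A : M.Ty Γ) (B : M.Ty (M.ext Γ A)) :
    M.tySub σ (Sig A B) = Sig (M.tySub σ A) (M.tySub (M.lift σ rfl) B)
  pair {Γ : C} {A : M.Ty Γ} {B : M.Ty (M.ext Γ A)} (a : M.Term A)
    (b : M.Term (M.tySub (M.inst a) B)) : M.Term (Sig A B)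
  pair_sub {Γ Δ : C} (σ : Δ ⟶ Γ) {A : M.Ty Γ} {B : M.Ty (M.ext Γ A)} (a : M.Term A)
    (b : M.Term (M.tySub (M.inst a) B)) :
    M.sub σ (Sig_sub σ A B) (pair a b) =
      pair (M.sub σ rfl a) (M.sub σ (M.tySub_inst σ B a) b)
  pair_bijective {Γ : C} (A : M.Ty Γ) (B : M.Ty (M.ext Γ A)) :
    Function.Bijective
      (fun x : (Σ a : M.Term A, M.Term (M.tySub (M.inst a) B)) => (pair x.1 x.2 : M.Term (Sig A B)))

/-- Extensional equality types: equality reflection and uniqueness of equality proofs. -/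
structure EqTypes where
  EqTy {Γ : C} {A : M.Ty Γ} (s t : M.Term A) : M.Ty Γ
  EqTy_sub {Γ Δ : C} (σ : Δ ⟶ Γ) {A : M.Ty Γ} (s t : M.Term A) :
    M.tySub σ (EqTy s t) = EqTy (M.sub σ rfl s) (M.sub σ rfl t)
  refl {Γ : C} {A : M.Ty Γ} (s : M.Term A) : M.Term (EqTy s s)
  reflection {Γ : C} {A : M.Ty Γ} {s t : M.Term A} (e : M.Term (EqTy s t)) : s = t
  uip {Γ : C} {A : M.Ty Γ} {s t : M.Term A} (e e' : M.Term (EqTy s t)) : e = e'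

/-- The empty, unit and boolean types. As equality is extensional, the dependent eliminators are
uniquely determined (and therefore stable under substitution), so that they are given by unique
existence. -/
structure FiniteTypes where
  Zero (Γ : C) : M.Ty Γ
  Zero_sub {Γ Δ : C} (σ : Δ ⟶ Γ) : M.tySub σ (Zero Γ) = Zero Δ
  zero_elim {Γ : C} (D : M.Ty (M.ext Γ (Zero Γ))) : ∃! _r : M.Term D, True
  One (Γ : C) : M.Ty Γ
  One_sub {Γ Δ : C} (σ : Δ ⟶ Γ) : M.tySub σ (One Γ) = One Δ
  star (Γ : C) : M.Term (One Γ)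
  star_unique {Γ : C} (t : M.Term (One Γ)) : t = star Γ
  Two (Γ : C) : M.Ty Γ
  Two_sub {Γ Δ : C} (σ : Δ ⟶ Γ) : M.tySub σ (Two Γ) = Two Δ
  tt (Γ : C) : M.Term (Two Γ)
  tt_sub {Γ Δ : C} (σ : Δ ⟶ Γ) : M.sub σ (Two_sub σ) (tt Γ) = tt Δ
  ff (Γ : C) : M.Term (Two Γ)
  ff_sub {Γ Δ : C} (σ : Δ ⟶ Γ) : M.sub σ (Two_sub σ) (ff Γ) = ff Δ
  two_elim {Γ : C} (D : M.Ty (M.ext Γ (Two Γ)))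
    (d₁ : M.Term (M.tySub (M.inst (tt Γ)) D)) (d₀ : M.Term (M.tySub (M.inst (ff Γ)) D)) :
    ∃! r : M.Term D, M.sub (M.inst (tt Γ)) rfl r = d₁ ∧ M.sub (M.inst (ff Γ)) rfl r = d₀

/-- Formation and introduction of `W`-types. The family of subtrees of `sup a f` is given as an
open term `Γ, x : B[a] ⊢ f : W A B`. -/
structure WFormers where
  W {Γ : C} (A : M.Ty Γ) (B : M.Ty (M.ext Γ A)) : M.Ty Γ
  W_sub {Γ Δ : C} (σ : Δ ⟶ Γ) (A : M.Ty Γ) (B : M.Ty (M.ext Γ A)) :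
    M.tySub σ (W A B) = W (M.tySub σ A) (M.tySub (M.lift σ rfl) B)
  sup {Γ : C} {A : M.Ty Γ} {B : M.Ty (M.ext Γ A)} (a : M.Term A)
    (f : M.Term (M.tySub (M.wk (M.tySub (M.inst a) B)) (W A B))) : M.Term (W A B)
  sup_sub {Γ Δ : C} (σ : Δ ⟶ Γ) {A : M.Ty Γ} {B : M.Ty (M.ext Γ A)} (a : M.Term A)
    (f : M.Term (M.tySub (M.wk (M.tySub (M.inst a) B)) (W A B))) :
    M.sub σ (W_sub σ A B) (sup a f) =
      sup (M.sub σ rfl a)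
        (M.sub (M.lift σ (M.tySub_inst σ B a)) (M.tySub_wk_lift σ _ (W_sub σ A B)) f)

namespace WFormers

variable {M} (T : M.WFormers) {Γ : C} {A : M.Ty Γ} {B : M.Ty (M.ext Γ A)}

/-- The `W`-type `W A B` in a context `Δ` over `Γ`. -/
abbrev WAt {Δ : C} (B : M.Ty (M.ext Γ A)) (σ : Δ ⟶ Γ) : M.Ty Δ :=
  T.W (M.tySub σ A) (M.tySub (M.lift σ rfl) B)

/-- The arity `B[σ, a]` of a label `a` in a context `Δ` over `Γ`. -/
abbrev Arity {Δ : C} (B : M.Ty (M.ext Γ A)) (σ : Δ ⟶ Γ) (a : M.Term (M.tySub σ A)) : M.Ty Δ :=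
  M.tySub (M.inst a) (M.tySub (M.lift σ rfl) B)

/-- The substitution `⟨σ, t⟩ : Δ ⟶ Γ.(W A B)`. -/
def consTree {Δ : C} (σ : Δ ⟶ Γ) (t : M.Term (T.WAt B σ)) : Δ ⟶ M.ext Γ (T.W A B) :=
  M.cons σ (T.W A B) t.1 (t.2.trans (T.W_sub σ A B).symm)

/-- The substitution `⟨σ, f⟩ : Δ.E ⟶ Γ.(W A B)` for a family `f` of trees indexed by `E`. -/
def consFam {Δ : C} (σ : Δ ⟶ Γ) {E : M.Ty Δ} (f : M.Term (M.tySub (M.wk E) (T.WAt B σ))) :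
    M.ext Δ E ⟶ M.ext Γ (T.W A B) :=
  M.cons (M.wk E ≫ σ) (T.W A B) f.1 (by rw [f.2, M.tySub_comp, T.W_sub σ])

theorem WAt_sub {Δ Θ : C} (τ : Θ ⟶ Δ) (σ : Δ ⟶ Γ) :
    M.tySub τ (T.WAt B σ) = T.WAt B (τ ≫ σ) := by
  rw [WAt, WAt, ← T.W_sub, ← T.W_sub, M.tySub_comp]

/-- Restriction of a label along `τ`. -/
abbrev labelSub {Δ Θ : C} (τ : Θ ⟶ Δ) (σ : Δ ⟶ Γ) (a : M.Term (M.tySub σ A)) :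
    M.Term (M.tySub (τ ≫ σ) A) :=
  M.sub τ (M.tySub_comp τ σ A).symm a

/-- The substitution `τ.B[a] : Θ.B[a[τ]] ⟶ Δ.B[a]`. -/
def arityLift {Δ Θ : C} (B : M.Ty (M.ext Γ A)) (τ : Θ ⟶ Δ) (σ : Δ ⟶ Γ)
    (a : M.Term (M.tySub σ A)) :
    M.ext Θ (Arity B (τ ≫ σ) (labelSub τ σ a)) ⟶ M.ext Δ (Arity B σ a) :=
  M.lift τ (M.tySub_lift_inst τ σ B a)

/-- Restriction of a family of subtrees along `τ`. -/
def famSub {Δ Θ : C} (τ : Θ ⟶ Δ) (σ : Δ ⟶ Γ) (a : M.Term (M.tySub σ A))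
    (f : M.Term (M.tySub (M.wk (Arity B σ a)) (T.WAt B σ))) :
    M.Term (M.tySub (M.wk (Arity B (τ ≫ σ) (labelSub τ σ a))) (T.WAt B (τ ≫ σ))) :=
  M.sub (arityLift B τ σ a) (M.tySub_wk_lift τ _ (T.WAt_sub τ σ)) f

theorem comp_consFam {Δ Θ : C} (τ : Θ ⟶ Δ) (σ : Δ ⟶ Γ) (a : M.Term (M.tySub σ A))
    (f : M.Term (M.tySub (M.wk (Arity B σ a)) (T.WAt B σ))) :
    arityLift B τ σ a ≫ T.consFam σ f = T.consFam (τ ≫ σ) (T.famSub τ σ a f) := by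
  apply M.hom_ext
  · simp only [consFam, Category.assoc, M.cons_wk]
    rw [← Category.assoc, ← Category.assoc]
    exact congrArg (· ≫ σ) (M.lift_wk τ (M.tySub_lift_inst τ σ B a))
  · simp only [consFam, M.tmSub_comp, M.var_cons, famSub, sub]

theorem sup_tmSub {Δ : C} (σ : Δ ⟶ Γ) {A' : M.Ty Δ} {B' : M.Ty (M.ext Δ A')}
    (h : M.tySub σ A = A') (hB : M.tySub (M.lift σ h) B = B') (a : M.Term A)
    (f : M.Term (M.tySub (M.wk (M.tySub (M.inst a) B)) (T.W A B)))
    (hE : M.tySub σ (M.tySub (M.inst a) B) = M.tySub (M.inst (M.sub σ h a)) B')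
    (hW : M.tySub (M.lift σ hE) (M.tySub (M.wk (M.tySub (M.inst a) B)) (T.W A B)) =
      M.tySub (M.wk (M.tySub (M.inst (M.sub σ h a)) B')) (T.W A' B')) :
    M.tmSub σ (T.sup a f).1 = (T.sup (M.sub σ h a) (M.sub (M.lift σ hE) hW f)).1 := by
  subst h
  subst hB
  exact congrArg Subtype.val (T.sup_sub σ a f)

theorem comp_consTree_sup {Δ Θ : C} (τ : Θ ⟶ Δ) (σ : Δ ⟶ Γ) (a : M.Term (M.tySub σ A))
    (f : M.Term (M.tySub (M.wk (Arity B σ a)) (T.WAt B σ))) :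
    τ ≫ T.consTree σ (T.sup a f) =
      T.consTree (τ ≫ σ) (T.sup (labelSub τ σ a) (T.famSub τ σ a f)) := by
  apply M.hom_ext
  · simp only [consTree, Category.assoc, M.cons_wk]
  · rw [M.tmSub_comp, consTree, consTree, M.var_cons, M.var_cons]
    refine T.sup_tmSub τ _ ?_ a f (M.tySub_lift_inst τ σ B a) _
    rw [← M.tySub_comp]
    congr 1
    rw [lift, M.cons_lift]
    apply M.hom_ext
    · rw [M.cons_wk, M.lift_wk, Category.assoc]
    · rw [M.var_cons, lift, M.var_cons]

/-- The premise of the induction principle of `W A B` for a family `w : W A B ⊢ D w`: a term of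
`D (sup a f)` depending on `a : A`, on `x : B a ⊢ f x : W A B` and on `x : B a ⊢ h x : D (f x)`,
that is, such a term for all instances of `a`, `f`, `h` in contexts over `Γ`, compatibly with
substitution. -/
structure Step (D : M.Ty (M.ext Γ (T.W A B))) where
  step {Δ : C} (σ : Δ ⟶ Γ) (a : M.Term (M.tySub σ A))
    (f : M.Term (M.tySub (M.wk (Arity B σ a)) (T.WAt B σ)))
    (h : M.Term (M.tySub (T.consFam σ f) D)) :
    M.Term (M.tySub (T.consTree σ (T.sup a f)) D)
  step_sub {Δ Θ : C} (τ : Θ ⟶ Δ) (σ : Δ ⟶ Γ) (a : M.Term (M.tySub σ A))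
    (f : M.Term (M.tySub (M.wk (Arity B σ a)) (T.WAt B σ)))
    (h : M.Term (M.tySub (T.consFam σ f) D)) :
    M.sub τ (by rw [← M.tySub_comp, T.comp_consTree_sup]) (step σ a f h) =
      step (τ ≫ σ) (labelSub τ σ a) (T.famSub τ σ a f)
        (M.sub (arityLift B τ σ a) (by rw [← M.tySub_comp, T.comp_consFam]) h)

end WFormers

/-- `W`-types, with dependent elimination. As equality is extensional, the eliminator is uniquely
determined (and therefore stable under substitution). -/
structure WTypes extends M.WFormers where
  W_elim {Γ : C} {A : M.Ty Γ} {B : M.Ty (M.ext Γ A)} (D : M.Ty (M.ext Γ (W A B)))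
    (d : toWFormers.Step D) :
    ∃! r : M.Term D, ∀ {Δ : C} (σ : Δ ⟶ Γ) (a : M.Term (M.tySub σ A))
      (f : M.Term (M.tySub (M.wk (WFormers.Arity B σ a)) (toWFormers.WAt B σ))),
      M.sub (toWFormers.consTree σ (sup a f)) rfl r =
        d.step σ a f (M.sub (toWFormers.consFam σ f) rfl r)

/-- The type formers of extensional type theory: dependent products and sums, extensional equality,
the empty, unit and boolean types, and `W`-types. -/
structure ExtTT extends M.PiTypes, M.SigmaTypes, M.EqTypes, M.FiniteTypes, M.WTypes

/-- A sequence of universes à la Tarski: closed types `U i` (given in every context, stably under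
substitution) with families `El`. -/
structure Universes where
  U (i : ℕ) (Γ : C) : M.Ty Γ
  U_sub (i : ℕ) {Γ Δ : C} (σ : Δ ⟶ Γ) : M.tySub σ (U i Γ) = U i Δ
  El {i : ℕ} {Γ : C} (a : M.Term (U i Γ)) : M.Ty Γ
  El_sub {i : ℕ} {Γ Δ : C} (σ : Δ ⟶ Γ) (a : M.Term (U i Γ)) :
    M.tySub σ (El a) = El (M.sub σ (U_sub i σ) a)

namespace Universes

variable {M} (U : M.Universes)

/-- The codes `Γ ⊢ a : U i`. -/
abbrev Code (i : ℕ) (Γ : C) : Type w' := M.Term (U.U i Γ)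

/-- Substitution on codes. -/
abbrev codeSub {i : ℕ} {Γ Δ : C} (σ : Δ ⟶ Γ) (a : U.Code i Γ) : U.Code i Δ :=
  M.sub σ (U.U_sub i σ) a

/-- The substitution `σ.(El a)`. -/
abbrev liftEl {i : ℕ} {Γ Δ : C} (σ : Δ ⟶ Γ) (a : U.Code i Γ) :
    M.ext Δ (U.El (U.codeSub σ a)) ⟶ M.ext Γ (U.El a) :=
  M.lift σ (U.El_sub σ a)

/-- The universal code, in the context consisting of one variable of type `U i`. -/
def univCode (i : ℕ) : U.Code i (M.ext M.nil (U.U i M.nil)) :=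
  ⟨M.var (U.U i M.nil), (M.tp_var _).trans (U.U_sub i _)⟩

/-- The generic family `(A : U i, x : El A) ⟶ (A : U i)` of the `i`-th universe. -/
def genericFamily (i : ℕ) :
    M.ext (M.ext M.nil (U.U i M.nil)) (U.El (U.univCode i)) ⟶ M.ext M.nil (U.U i M.nil) :=
  M.wk (U.El (U.univCode i))

/-- The class of morphisms for which the `i`-th universe is generic: the pullbacks of its generic
family. -/
def classified (i : ℕ) : MorphismProperty C := fun X Y f =>
  ∃ (g : X ⟶ M.ext (M.ext M.nil (U.U i M.nil)) (U.El (U.univCode i)))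
    (c : Y ⟶ M.ext M.nil (U.U i M.nil)), IsPullback g f (U.genericFamily i) c

/-- The types which have, on the nose, a code in the `i`-th universe. -/
def IsSmall (i : ℕ) {Γ : C} (A : M.Ty Γ) : Prop := ∃ a : U.Code i Γ, U.El a = A

end Universes

/-- A strictly cumulative hierarchy of universes à la Tarski. Every universe has codes for all type
formers and for all earlier universes, which are stable under substitution and are decoded strictly
to the types they stand for. The coercions `cum` from lower to higher universes are functorial,
and commute strictly with substitution, with decoding and with all codes. -/
structure Hierarchy (T : M.ExtTT) extends M.Universes where
  cum {i j : ℕ} (h : i ≤ j) {Γ : C} (a : M.Term (U i Γ)) : M.Term (U j Γ)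
  cum_sub {i j : ℕ} (h : i ≤ j) {Γ Δ : C} (σ : Δ ⟶ Γ) (a : M.Term (U i Γ)) :
    toUniverses.codeSub σ (cum h a) = cum h (toUniverses.codeSub σ a)
  cum_refl {i : ℕ} {Γ : C} (a : M.Term (U i Γ)) : cum le_rfl a = a
  cum_trans {i j k : ℕ} (h : i ≤ j) (h' : j ≤ k) {Γ : C} (a : M.Term (U i Γ)) :
    cum h' (cum h a) = cum (h.trans h') a
  El_cum {i j : ℕ} (h : i ≤ j) {Γ : C} (a : M.Term (U i Γ)) : El a = El (cum h a)
  /-- the code of the universe `U i` in the universe `U j` -/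
  uni {i j : ℕ} (h : i < j) (Γ : C) : M.Term (U j Γ)
  uni_sub {i j : ℕ} (h : i < j) {Γ Δ : C} (σ : Δ ⟶ Γ) :
    toUniverses.codeSub σ (uni h Γ) = uni h Δ
  El_uni {i j : ℕ} (h : i < j) (Γ : C) : El (uni h Γ) = U i Γ
  cum_uni {i j k : ℕ} (h : i < j) (h' : j ≤ k) (Γ : C) :
    cum h' (uni h Γ) = uni (h.trans_le h') Γ
  /-- the code of a dependent product -/
  pi {i : ℕ} {Γ : C} (a : M.Term (U i Γ)) (b : M.Term (U i (M.ext Γ (El a)))) : M.Term (U i Γ)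
  pi_sub {i : ℕ} {Γ Δ : C} (σ : Δ ⟶ Γ) (a : M.Term (U i Γ))
    (b : M.Term (U i (M.ext Γ (El a)))) :
    toUniverses.codeSub σ (pi a b) =
      pi (toUniverses.codeSub σ a) (toUniverses.codeSub (toUniverses.liftEl σ a) b)
  El_pi {i : ℕ} {Γ : C} (a : M.Term (U i Γ)) (b : M.Term (U i (M.ext Γ (El a)))) :
    El (pi a b) = T.Pi (El a) (El b)
  cum_pi {i j : ℕ} (h : i ≤ j) {Γ : C} (a : M.Term (U i Γ))
    (b : M.Term (U i (M.ext Γ (El a)))) :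
    cum h (pi a b) = pi (cum h a) (cum h (toUniverses.codeSub (M.castCtx (El_cum h a)) b))
  /-- the code of a dependent sum -/
  sg {i : ℕ} {Γ : C} (a : M.Term (U i Γ)) (b : M.Term (U i (M.ext Γ (El a)))) : M.Term (U i Γ)
  sg_sub {i : ℕ} {Γ Δ : C} (σ : Δ ⟶ Γ) (a : M.Term (U i Γ))
    (b : M.Term (U i (M.ext Γ (El a)))) :
    toUniverses.codeSub σ (sg a b) =
      sg (toUniverses.codeSub σ a) (toUniverses.codeSub (toUniverses.liftEl σ a) b)
  El_sg {i : ℕ} {Γ : C} (a : M.Term (U i Γ)) (b : M.Term (U i (M.ext Γ (El a)))) :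
    El (sg a b) = T.Sig (El a) (El b)
  cum_sg {i j : ℕ} (h : i ≤ j) {Γ : C} (a : M.Term (U i Γ))
    (b : M.Term (U i (M.ext Γ (El a)))) :
    cum h (sg a b) = sg (cum h a) (cum h (toUniverses.codeSub (M.castCtx (El_cum h a)) b))
  /-- the code of a `W`-type -/
  wt {i : ℕ} {Γ : C} (a : M.Term (U i Γ)) (b : M.Term (U i (M.ext Γ (El a)))) : M.Term (U i Γ)
  wt_sub {i : ℕ} {Γ Δ : C} (σ : Δ ⟶ Γ) (a : M.Term (U i Γ))
    (b : M.Term (U i (M.ext Γ (El a)))) :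
    toUniverses.codeSub σ (wt a b) =
      wt (toUniverses.codeSub σ a) (toUniverses.codeSub (toUniverses.liftEl σ a) b)
  El_wt {i : ℕ} {Γ : C} (a : M.Term (U i Γ)) (b : M.Term (U i (M.ext Γ (El a)))) :
    El (wt a b) = T.W (El a) (El b)
  cum_wt {i j : ℕ} (h : i ≤ j) {Γ : C} (a : M.Term (U i Γ))
    (b : M.Term (U i (M.ext Γ (El a)))) :
    cum h (wt a b) = wt (cum h a) (cum h (toUniverses.codeSub (M.castCtx (El_cum h a)) b))
  /-- the code of an equality type -/
  eq {i : ℕ} {Γ : C} (a : M.Term (U i Γ)) (s t : M.Term (El a)) : M.Term (U i Γ)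
  eq_sub {i : ℕ} {Γ Δ : C} (σ : Δ ⟶ Γ) (a : M.Term (U i Γ)) (s t : M.Term (El a)) :
    toUniverses.codeSub σ (eq a s t) =
      eq (toUniverses.codeSub σ a) (M.sub σ (El_sub σ a) s) (M.sub σ (El_sub σ a) t)
  El_eq {i : ℕ} {Γ : C} (a : M.Term (U i Γ)) (s t : M.Term (El a)) :
    El (eq a s t) = T.EqTy s t
  cum_eq {i j : ℕ} (h : i ≤ j) {Γ : C} (a : M.Term (U i Γ)) (s t : M.Term (El a)) :
    cum h (eq a s t) = eq (cum h a) (M.castTm (El_cum h a) s) (M.castTm (El_cum h a) t)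
  /-- the code of the empty type -/
  zero (i : ℕ) (Γ : C) : M.Term (U i Γ)
  zero_sub (i : ℕ) {Γ Δ : C} (σ : Δ ⟶ Γ) : toUniverses.codeSub σ (zero i Γ) = zero i Δ
  El_zero (i : ℕ) (Γ : C) : El (zero i Γ) = T.Zero Γ
  cum_zero {i j : ℕ} (h : i ≤ j) (Γ : C) : cum h (zero i Γ) = zero j Γ
  /-- the code of the unit type -/
  one (i : ℕ) (Γ : C) : M.Term (U i Γ)
  one_sub (i : ℕ) {Γ Δ : C} (σ : Δ ⟶ Γ) : toUniverses.codeSub σ (one i Γ) = one i Δ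
  El_one (i : ℕ) (Γ : C) : El (one i Γ) = T.One Γ
  cum_one {i j : ℕ} (h : i ≤ j) (Γ : C) : cum h (one i Γ) = one j Γ
  /-- the code of the type of booleans -/
  two (i : ℕ) (Γ : C) : M.Term (U i Γ)
  two_sub (i : ℕ) {Γ Δ : C} (σ : Δ ⟶ Γ) : toUniverses.codeSub σ (two i Γ) = two i Δ
  El_two (i : ℕ) (Γ : C) : El (two i Γ) = T.Two Γ
  cum_two {i j : ℕ} (h : i ≤ j) (Γ : C) : cum h (two i Γ) = two j Γ

namespace Hierarchy

variable {M} {T : M.ExtTT}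

/-- The codes of the hierarchy are injective: in every context, a code of a dependent product, of a
dependent sum, of a `W`-type or of an equality type determines the arguments it is formed from.
(As equality is extensional, this is injectivity in the internal sense.) -/
structure InjectiveCodes (V : M.Hierarchy T) : Prop where
  pi_injective (i : ℕ) (Γ : C) : Function.Injective
    (fun x : (Σ a : V.Code i Γ, V.Code i (M.ext Γ (V.El a))) => V.pi x.1 x.2)
  sg_injective (i : ℕ) (Γ : C) : Function.Injective
    (fun x : (Σ a : V.Code i Γ, V.Code i (M.ext Γ (V.El a))) => V.sg x.1 x.2)
  wt_injective (i : ℕ) (Γ : C) : Function.Injective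
    (fun x : (Σ a : V.Code i Γ, V.Code i (M.ext Γ (V.El a))) => V.wt x.1 x.2)
  eq_injective (i : ℕ) (Γ : C) : Function.Injective
    (fun x : (Σ a : V.Code i Γ, M.Term (V.El a) × M.Term (V.El a)) => V.eq x.1 x.2.1 x.2.2)

/-- `V` replaces `U`: there are functions `up : U i → V i` and `dec : V i → U i` (natural in the
context) with `dec ∘ up = id`, such that `V i` is decoded through `dec`, both functions commute with
the coercions, and `dec` sends the codes of the type formers in `V` to those in `U`. -/
structure Replacement (U V : M.Hierarchy T) where
  up {i : ℕ} {Γ : C} (a : U.Code i Γ) : V.Code i Γ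
  up_sub {i : ℕ} {Γ Δ : C} (σ : Δ ⟶ Γ) (a : U.Code i Γ) :
    V.codeSub σ (up a) = up (U.codeSub σ a)
  dec {i : ℕ} {Γ : C} (a : V.Code i Γ) : U.Code i Γ
  dec_sub {i : ℕ} {Γ Δ : C} (σ : Δ ⟶ Γ) (a : V.Code i Γ) :
    U.codeSub σ (dec a) = dec (V.codeSub σ a)
  dec_up {i : ℕ} {Γ : C} (a : U.Code i Γ) : dec (up a) = a
  El_dec {i : ℕ} {Γ : C} (a : V.Code i Γ) : V.El a = U.El (dec a)
  cum_up {i j : ℕ} (h : i ≤ j) {Γ : C} (a : U.Code i Γ) : V.cum h (up a) = up (U.cum h a)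
  dec_cum {i j : ℕ} (h : i ≤ j) {Γ : C} (a : V.Code i Γ) : dec (V.cum h a) = U.cum h (dec a)
  dec_pi {i : ℕ} {Γ : C} (a : V.Code i Γ) (b : V.Code i (M.ext Γ (V.El a))) :
    dec (V.pi a b) = U.pi (dec a) (U.codeSub (M.castCtx (El_dec a)) (dec b))
  dec_sg {i : ℕ} {Γ : C} (a : V.Code i Γ) (b : V.Code i (M.ext Γ (V.El a))) :
    dec (V.sg a b) = U.sg (dec a) (U.codeSub (M.castCtx (El_dec a)) (dec b))
  dec_wt {i : ℕ} {Γ : C} (a : V.Code i Γ) (b : V.Code i (M.ext Γ (V.El a))) :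
    dec (V.wt a b) = U.wt (dec a) (U.codeSub (M.castCtx (El_dec a)) (dec b))
  dec_eq {i : ℕ} {Γ : C} (a : V.Code i Γ) (s t : M.Term (V.El a)) :
    dec (V.eq a s t) = U.eq (dec a) (M.castTm (El_dec a) s) (M.castTm (El_dec a) t)
  dec_zero (i : ℕ) (Γ : C) : dec (V.zero i Γ) = U.zero i Γ
  dec_one (i : ℕ) (Γ : C) : dec (V.one i Γ) = U.one i Γ
  dec_two (i : ℕ) (Γ : C) : dec (V.two i Γ) = U.two i Γ

end Hierarchy

end NatModel

/-! The new universe `V i` is a `W`-type of trees. A node carries two codes of `U i`: a value `d`,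
and an arity `n` whose decoding indexes the subtrees. Decoding reads off the value at the root, so
`El` on trees is `El` of the root value; a code of `U i` becomes the childless tree with that value.
Hence `dec (up d) = d`, and both hierarchies decode to exactly the same types.

A node is free to remember more than its value. The code of `Π`, `Σ` or `W` formed from `a` and `b`
has the value prescribed by `U`, and as subtrees the tree `a` and a node of arity `dec a` with
subtrees `b`. Injectivity thus reduces to injectivity of `sup` (`ClosedFam.sup_injective`), whatever
the codes of `U` identify. An equality code must also remember two elements `s`, `t`, which are not
trees; each is recorded by the code of its singleton predicate `x = s`, a family of codes over the
type, and equality reflection recovers the element (`eqCode_injective`).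

Coercions act on values and arities at every node. Their laws are equalities of recursively defined
maps, and these hold strictly because elimination has unique solutions in extensional type theory
(`node_rec_unique`). The type of trees over `U i` is a `W`-type over `U i × U i` with arities in `U
i`, so `U (i + 1)` has a code for it (`treeCode`); this supplies the codes of the new universes.

All data are closed types and families natural in the context. The elimination principle is
therefore applied over the empty context and spread to other contexts by substitution
(`exists_recursor`, `Recursor.unique`). -/

namespace NatModel

/-! ### Substitution calculus and transport along equalities of types. -/

section Basic

variable {C : Type u} [Category.{v} C] {M : NatModel.{u, v, w, w'} C}

theorem sub_sub {Γ Δ Θ : C} (τ : Θ ⟶ Δ) (σ : Δ ⟶ Γ) {A : M.Ty Γ} {A' : M.Ty Δ} {A'' : M.Ty Θ}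
    (h : M.tySub σ A = A') (h' : M.tySub τ A' = A'') (t : M.Term A) :
    M.sub τ h' (M.sub σ h t) = M.sub (τ ≫ σ) ((M.tySub_comp τ σ A).trans (by rw [h, h'])) t :=
  Subtype.ext (M.tmSub_comp τ σ t.1).symm

theorem tmSub_comm {Γ Δ Δ' Θ : C} {τ : Θ ⟶ Δ} {σ : Δ ⟶ Γ} {τ' : Θ ⟶ Δ'} {σ' : Δ' ⟶ Γ}
    (e : τ ≫ σ = τ' ≫ σ') (t : M.Tm Γ) :
    M.tmSub τ (M.tmSub σ t) = M.tmSub τ' (M.tmSub σ' t) := by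
  rw [← M.tmSub_comp, e, M.tmSub_comp]

theorem lift_id {Γ : C} {A : M.Ty Γ} (h : M.tySub (𝟙 Γ) A = A) :
    M.lift (𝟙 Γ) h = 𝟙 (M.ext Γ A) := by
  apply M.hom_ext
  · rw [M.lift_wk, Category.comp_id, Category.id_comp]
  · rw [lift, M.var_cons, M.tmSub_id]

theorem castCtx_rfl {Γ : C} {A : M.Ty Γ} (h : A = A) : M.castCtx h = 𝟙 (M.ext Γ A) :=
  lift_id _

theorem castCtx_comp_lift {Γ Δ : C} (σ : Δ ⟶ Γ) {A : M.Ty Γ} {A' A'' : M.Ty Δ}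
    (h : M.tySub σ A = A') (h' : A' = A'') :
    M.castCtx h' ≫ M.lift σ h = M.lift σ (h.trans h') := by
  subst h'
  rw [castCtx_rfl, Category.id_comp]

theorem lift_comp_castCtx {Γ Δ : C} (σ : Δ ⟶ Γ) {A₀ A : M.Ty Γ} {A' : M.Ty Δ}
    (h : M.tySub σ A = A') (h' : A₀ = A) :
    M.lift σ h ≫ M.castCtx h' = M.lift σ (by rw [h', h]) := by
  subst h'
  rw [castCtx_rfl, Category.comp_id]

theorem castCtx_comp {Γ : C} {A A' A'' : M.Ty Γ} (h : A = A') (h' : A' = A'') :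
    M.castCtx h' ≫ M.castCtx h = M.castCtx (h.trans h') := by
  subst h'
  rw [castCtx_rfl, Category.id_comp]

theorem castCtx_wk {Γ : C} {A A' : M.Ty Γ} (h : A = A') :
    M.castCtx h ≫ M.wk A = M.wk A' := by
  subst h
  rw [castCtx_rfl, Category.id_comp]

theorem tmSub_castCtx_var {Γ : C} {A A' : M.Ty Γ} (h : A = A') :
    M.tmSub (M.castCtx h) (M.var A) = M.var A' := by
  subst h
  rw [castCtx_rfl, M.tmSub_id]

theorem tmSub_castCtx_symm {Γ : C} {A A' : M.Ty Γ} (h : A = A') (h' : A' = A)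
    (t : M.Tm (M.ext Γ A)) : M.tmSub (M.castCtx h') (M.tmSub (M.castCtx h) t) = t := by
  rw [← M.tmSub_comp, castCtx_comp, castCtx_rfl, M.tmSub_id]

theorem inst_wk {Γ : C} {A : M.Ty Γ} (a : M.Term A) : M.inst a ≫ M.wk A = 𝟙 Γ :=
  M.cons_wk _ _ _ _

theorem tmSub_inst_var {Γ : C} {A : M.Ty Γ} (a : M.Term A) : M.tmSub (M.inst a) (M.var A) = a.1 :=
  M.var_cons _ _ _ _

theorem tmSub_lift_var {Γ Δ : C} (σ : Δ ⟶ Γ) {A : M.Ty Γ} {A' : M.Ty Δ} (h : M.tySub σ A = A') :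
    M.tmSub (M.lift σ h) (M.var A) = M.var A' :=
  M.var_cons _ _ _ _

/-- A map into `Γ.A` is a map into `Γ` with a term, so a cone over the square is a map into `Δ`
together with a term of `A'`, which is a map into `Δ.A'`. -/
theorem isPullback_lift {Γ Δ : C} (σ : Δ ⟶ Γ) {A : M.Ty Γ} {A' : M.Ty Δ}
    (h : M.tySub σ A = A') : IsPullback (M.lift σ h) (M.wk A') (M.wk A) σ := by
  refine ⟨⟨M.lift_wk σ h⟩, ⟨Limits.PullbackCone.IsLimit.mk _
    (fun s => M.cons s.snd A' (M.tmSub s.fst (M.var A)) ?_) ?_ ?_ ?_⟩⟩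
  · rw [M.tp_tmSub, M.tp_var, ← M.tySub_comp, s.condition, M.tySub_comp, h]
  · intro s
    rw [M.cons_lift]
    apply M.hom_ext
    · rw [M.cons_wk, s.condition]
    · rw [M.var_cons]
  · intro s
    rw [M.cons_wk]
  · intro s m h₁ h₂
    apply M.hom_ext
    · rw [M.cons_wk, h₂]
    · rw [M.var_cons, ← h₁, M.tmSub_comp, tmSub_lift_var]

/-- The substituted types are allowed to be known only up to a proved equality, as happens for
closed types, which are stable by hypothesis rather than by definition. The variants below serve the
same purpose. -/
theorem PiTypes.Pi_tySub (P : M.PiTypes) {Γ Δ : C} (σ : Δ ⟶ Γ) {A : M.Ty Γ} {B : M.Ty (M.ext Γ A)}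
    {A' : M.Ty Δ} {B' : M.Ty (M.ext Δ A')} (h : M.tySub σ A = A')
    (hB : M.tySub (M.lift σ h) B = B') : M.tySub σ (P.Pi A B) = P.Pi A' B' := by
  subst h
  subst hB
  exact P.Pi_sub σ A B

theorem PiTypes.lam_tmSub (P : M.PiTypes) {Γ Δ : C} (σ : Δ ⟶ Γ) {A : M.Ty Γ}
    {B : M.Ty (M.ext Γ A)} {A' : M.Ty Δ} {B' : M.Ty (M.ext Δ A')} (h : M.tySub σ A = A')
    (hB : M.tySub (M.lift σ h) B = B') (b : M.Term B) :
    M.tmSub σ (P.lam b).1 = (P.lam (M.sub (M.lift σ h) hB b)).1 := by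
  subst h
  subst hB
  exact congrArg Subtype.val (P.lam_sub σ b)

theorem SigmaTypes.Sig_tySub (S : M.SigmaTypes) {Γ Δ : C} (σ : Δ ⟶ Γ) {A : M.Ty Γ}
    {B : M.Ty (M.ext Γ A)} {A' : M.Ty Δ} {B' : M.Ty (M.ext Δ A')} (h : M.tySub σ A = A')
    (hB : M.tySub (M.lift σ h) B = B') : M.tySub σ (S.Sig A B) = S.Sig A' B' := by
  subst h
  subst hB
  exact S.Sig_sub σ A B

theorem SigmaTypes.pair_tmSub (S : M.SigmaTypes) {Γ Δ : C} (σ : Δ ⟶ Γ) {A : M.Ty Γ}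
    {B : M.Ty (M.ext Γ A)} {A' : M.Ty Δ} {B' : M.Ty (M.ext Δ A')} (h : M.tySub σ A = A')
    (hB : M.tySub (M.lift σ h) B = B') (a : M.Term A) (b : M.Term (M.tySub (M.inst a) B))
    (hb : M.tySub σ (M.tySub (M.inst a) B) = M.tySub (M.inst (M.sub σ h a)) B') :
    M.tmSub σ (S.pair a b).1 = (S.pair (M.sub σ h a) (M.sub σ hb b)).1 := by
  subst h
  subst hB
  exact congrArg Subtype.val (S.pair_sub σ a b)

theorem WFormers.W_tySub (T : M.WFormers) {Γ Δ : C} (σ : Δ ⟶ Γ) {A : M.Ty Γ}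
    {B : M.Ty (M.ext Γ A)} {A' : M.Ty Δ} {B' : M.Ty (M.ext Δ A')} (h : M.tySub σ A = A')
    (hB : M.tySub (M.lift σ h) B = B') : M.tySub σ (T.W A B) = T.W A' B' := by
  subst h
  subst hB
  exact T.W_sub σ A B

end Basic

/-! ### Closed types, closed families and closed `W`-types. -/

/-- A closed type, given in every context, stably under substitution. -/
structure ClosedTy {C : Type u} [Category.{v} C] (M : NatModel.{u, v, w, w'} C) where
  ty (Γ : C) : M.Ty Γ
  ty_sub {Γ Δ : C} (σ : Δ ⟶ Γ) : M.tySub σ (ty Γ) = ty Δ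

namespace ClosedTy

variable {C : Type u} [Category.{v} C] {M : NatModel.{u, v, w, w'} C} (X : M.ClosedTy)

/-- The terms of a closed type in a context. -/
abbrev Tm (Γ : C) : Type w' := M.Term (X.ty Γ)

/-- Substitution in the terms of a closed type. -/
abbrev sub {Γ Δ : C} (σ : Δ ⟶ Γ) (t : X.Tm Γ) : X.Tm Δ := M.sub σ (X.ty_sub σ) t

theorem sub_sub {Γ Δ Θ : C} (τ : Θ ⟶ Δ) (σ : Δ ⟶ Γ) (t : X.Tm Γ) :
    X.sub τ (X.sub σ t) = X.sub (τ ≫ σ) t :=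
  NatModel.sub_sub τ σ _ _ t

theorem sub_id {Γ : C} (t : X.Tm Γ) : X.sub (𝟙 Γ) t = t :=
  Subtype.ext (M.tmSub_id t.1)

/-- The last variable of a context extended by a closed type. -/
def var (Γ : C) : X.Tm (M.ext Γ (X.ty Γ)) :=
  ⟨M.var (X.ty Γ), (M.tp_var _).trans (X.ty_sub _)⟩

theorem sub_lift_var {Γ Δ : C} (σ : Δ ⟶ Γ) :
    X.sub (M.lift σ (X.ty_sub σ)) (X.var Γ) = X.var Δ :=
  Subtype.ext (tmSub_lift_var σ _)

/-- The substitution into the context with one variable of type `X` given by a term of `X`. -/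
def point {Γ : C} (t : X.Tm Γ) : Γ ⟶ M.ext M.nil (X.ty M.nil) :=
  M.cons (M.nilTerminal.from Γ) (X.ty M.nil) t.1 (t.2.trans (X.ty_sub _).symm)

theorem sub_point_var {Γ : C} (t : X.Tm Γ) : X.sub (X.point t) (X.var M.nil) = t :=
  Subtype.ext (M.var_cons _ _ _ _)

/-- The empty context is terminal, so only the term component matters. Natural operations on `X` are
thereby determined by their value at the universal variable. -/
theorem eq_point {Γ : C} (σ : Γ ⟶ M.ext M.nil (X.ty M.nil)) :
    σ = X.point (X.sub σ (X.var M.nil)) := by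
  apply M.hom_ext
  · exact M.nilTerminal.hom_ext _ _
  · exact (M.var_cons _ _ _ _).symm

theorem comp_point {Γ Δ : C} (σ : Δ ⟶ Γ) (t : X.Tm Γ) :
    σ ≫ X.point t = X.point (X.sub σ t) := by
  rw [X.eq_point (σ ≫ X.point t), ← X.sub_sub, X.sub_point_var]

end ClosedTy

/-- A family of types over a closed type, stable under substitution. -/
structure ClosedFam {C : Type u} [Category.{v} C] {M : NatModel.{u, v, w, w'} C}
    (X : M.ClosedTy) where
  fam {Γ : C} (a : X.Tm Γ) : M.Ty Γ
  fam_sub {Γ Δ : C} (σ : Δ ⟶ Γ) (a : X.Tm Γ) : M.tySub σ (fam a) = fam (X.sub σ a)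

namespace ClosedFam

variable {C : Type u} [Category.{v} C] {M : NatModel.{u, v, w, w'} C} {L : M.ClosedTy}
  (B : ClosedFam L)

/-- The substitution `σ.(B a)`. -/
abbrev liftFam {Γ Δ : C} (σ : Δ ⟶ Γ) (a : L.Tm Γ) :
    M.ext Δ (B.fam (L.sub σ a)) ⟶ M.ext Γ (B.fam a) :=
  M.lift σ (B.fam_sub σ a)

/-- The family regarded as a type in context. -/
abbrev openTy (Γ : C) : M.Ty (M.ext Γ (L.ty Γ)) := B.fam (L.var Γ)

theorem openTy_sub_of_eq {Γ Δ : C} (σ : Δ ⟶ M.ext Γ (L.ty Γ)) (a : L.Tm Δ)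
    (h : M.tmSub σ (M.var (L.ty Γ)) = a.1) : M.tySub σ (B.openTy Γ) = B.fam a := by
  rw [B.fam_sub]
  exact congrArg B.fam (Subtype.ext h)

theorem openTy_inst {Γ : C} (a : L.Tm Γ) : M.tySub (M.inst a) (B.openTy Γ) = B.fam a :=
  B.openTy_sub_of_eq _ _ (tmSub_inst_var a)

theorem openTy_lift {Γ Δ : C} (σ : Δ ⟶ Γ) :
    M.tySub (M.lift σ (L.ty_sub σ)) (B.openTy Γ) = B.openTy Δ :=
  B.openTy_sub_of_eq _ _ (tmSub_lift_var σ _)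

/-- The closed `W`-type of a closed family. -/
def wTy (T : M.WFormers) : M.ClosedTy where
  ty Γ := T.W (L.ty Γ) (B.openTy Γ)
  ty_sub σ := T.W_tySub σ (L.ty_sub σ) (B.openTy_lift σ)

variable (T : M.WFormers)

/-- The tree with a given label and a given family of subtrees. -/
def sup {Γ : C} (a : L.Tm Γ) (f : (B.wTy T).Tm (M.ext Γ (B.fam a))) : (B.wTy T).Tm Γ :=
  T.sup a (M.sub (M.castCtx (B.openTy_inst a).symm)
    (((B.wTy T).ty_sub _).trans ((B.wTy T).ty_sub _).symm) f)

theorem sup_sub {Γ Δ : C} (σ : Δ ⟶ Γ) (a : L.Tm Γ) (f : (B.wTy T).Tm (M.ext Γ (B.fam a))) :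
    (B.wTy T).sub σ (B.sup T a f) = B.sup T (L.sub σ a) ((B.wTy T).sub (B.liftFam σ a) f) := by
  apply Subtype.ext
  refine (T.sup_tmSub σ (L.ty_sub σ) (B.openTy_lift σ) a _
    (by rw [openTy_inst, openTy_inst, B.fam_sub])
    (((B.wTy T).ty_sub _ |> fun h => (congrArg (M.tySub _) h).trans
      (((B.wTy T).ty_sub _).trans ((B.wTy T).ty_sub _).symm)))).trans ?_
  refine congrArg (fun g => (T.sup (L.sub σ a) g).1) (Subtype.ext ?_)
  exact tmSub_comm ((lift_comp_castCtx _ _ _).trans (castCtx_comp_lift _ _ _).symm) _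

theorem sup_val {Γ : C} {A' : M.Ty Γ} {B' : M.Ty (M.ext Γ A')} (h : A' = L.ty Γ)
    (hB : M.tySub (M.castCtx h) B' = B.openTy Γ) (a : M.Term A')
    (f : M.Term (M.tySub (M.wk (M.tySub (M.inst a) B')) (T.W A' B')))
    (hE : M.tySub (M.inst a) B' = B.fam (M.castTm h a))
    (hf : M.tySub (M.castCtx hE) (M.tySub (M.wk (M.tySub (M.inst a) B')) (T.W A' B')) =
      (B.wTy T).ty _) :
    (T.sup a f).1 = (B.sup T (M.castTm h a) (M.sub (M.castCtx hE) hf f)).1 := by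
  subst h
  rw [castCtx_rfl, M.tySub_id] at hB
  subst hB
  refine congrArg (fun g => (T.sup a g).1) (Subtype.ext ?_)
  exact (tmSub_castCtx_symm hE (B.openTy_inst a).symm f.1).symm

end ClosedFam

end NatModel

/-! ### Dependent elimination for closed `W`-types, with uniqueness. -/

namespace NatModel.ClosedFam

variable {C : Type u} [Category.{v} C] {M : NatModel.{u, v, w, w'} C} {L : M.ClosedTy}

/-- The premise of the dependent elimination of a closed `W`-type, in terms of closed families. -/
structure ClosedStep (B : ClosedFam L) (T : M.WFormers) (D : ClosedFam (B.wTy T)) where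
  step {Γ : C} (a : L.Tm Γ) (f : (B.wTy T).Tm (M.ext Γ (B.fam a))) (h : M.Term (D.fam f)) :
    M.Term (D.fam (B.sup T a f))
  step_sub {Γ Δ : C} (σ : Δ ⟶ Γ) (a : L.Tm Γ) (f : (B.wTy T).Tm (M.ext Γ (B.fam a)))
    (h : M.Term (D.fam f)) :
    M.tmSub σ (step a f h).1 =
      (step (L.sub σ a) ((B.wTy T).sub (B.liftFam σ a) f)
        (M.sub (B.liftFam σ a) (D.fam_sub _ f) h)).1

/-- A section of a family over a closed `W`-type which satisfies the equation of the recursion. -/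
structure Recursor {B : ClosedFam L} {T : M.WFormers} {D : ClosedFam (B.wTy T)}
    (d : ClosedStep B T D) where
  app {Γ : C} (t : (B.wTy T).Tm Γ) : M.Term (D.fam t)
  app_sub {Γ Δ : C} (σ : Δ ⟶ Γ) (t : (B.wTy T).Tm Γ) :
    M.tmSub σ (app t).1 = (app ((B.wTy T).sub σ t)).1
  app_sup {Γ : C} (a : L.Tm Γ) (f : (B.wTy T).Tm (M.ext Γ (B.fam a))) :
    app (B.sup T a f) = d.step a f (app f)

section

variable (B : ClosedFam L) (T : M.WFormers) {Γ : C} (σ : Γ ⟶ M.nil)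

/-- Elimination over the empty context speaks of types substituted along `σ : Γ ⟶ nil`. This and the
next few facts identify them with the closed data in `Γ`. -/
theorem arity_eq (a : M.Term (M.tySub σ (L.ty M.nil))) :
    WFormers.Arity (B.openTy M.nil) σ a = B.fam (M.castTm (L.ty_sub σ) a) := by
  rw [WFormers.Arity, ← M.tySub_comp]
  refine B.openTy_sub_of_eq _ _ ?_
  rw [M.tmSub_comp, tmSub_lift_var, tmSub_inst_var]
  rfl

theorem wAt_eq : T.WAt (B.openTy M.nil) σ = (B.wTy T).ty Γ :=
  (T.W_sub σ _ _).symm.trans ((B.wTy T).ty_sub σ)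

/-- A family of subtrees over the empty context, as a family of trees of the closed `W`-type. -/
def closeFam (a : M.Term (M.tySub σ (L.ty M.nil)))
    (f : M.Term (M.tySub (M.wk (WFormers.Arity (B.openTy M.nil) σ a))
      (T.WAt (B.openTy M.nil) σ))) :
    (B.wTy T).Tm (M.ext Γ (B.fam (M.castTm (L.ty_sub σ) a))) :=
  M.sub (M.castCtx (B.arity_eq σ a))
    ((congrArg (fun X => M.tySub _ (M.tySub _ X)) (B.wAt_eq T σ)).trans
      ((congrArg (M.tySub _) ((B.wTy T).ty_sub _)).trans ((B.wTy T).ty_sub _))) f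

theorem sup_closeFam (a : M.Term (M.tySub σ (L.ty M.nil)))
    (f : M.Term (M.tySub (M.wk (WFormers.Arity (B.openTy M.nil) σ a))
      (T.WAt (B.openTy M.nil) σ))) :
    (T.sup a f).1 = (B.sup T (M.castTm (L.ty_sub σ) a) (B.closeFam T σ a f)).1 := by
  refine B.sup_val T (L.ty_sub σ) ?_ a f (B.arity_eq σ a) _
  rw [← M.tySub_comp, castCtx_comp_lift]
  exact B.openTy_lift σ

variable {B T} (D : ClosedFam (B.wTy T))

theorem openTy_consTree (a : M.Term (M.tySub σ (L.ty M.nil)))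
    (f : M.Term (M.tySub (M.wk (WFormers.Arity (B.openTy M.nil) σ a))
      (T.WAt (B.openTy M.nil) σ))) :
    M.tySub (T.consTree σ (T.sup a f)) (D.openTy M.nil) =
      D.fam (B.sup T (M.castTm (L.ty_sub σ) a) (B.closeFam T σ a f)) :=
  D.openTy_sub_of_eq _ _ ((M.var_cons _ _ _ _).trans (B.sup_closeFam T σ a f))

theorem openTy_consFam (a : M.Term (M.tySub σ (L.ty M.nil)))
    (f : M.Term (M.tySub (M.wk (WFormers.Arity (B.openTy M.nil) σ a))
      (T.WAt (B.openTy M.nil) σ))) :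
    M.tySub (M.castCtx (B.arity_eq σ a)) (M.tySub (T.consFam σ f) (D.openTy M.nil)) =
      D.fam (B.closeFam T σ a f) := by
  refine (M.tySub_comp _ _ _).symm.trans (D.openTy_sub_of_eq _ _ ?_)
  exact (M.tmSub_comp _ _ _).trans (congrArg _ (M.var_cons _ _ _ _))

end

variable {B : ClosedFam L}

theorem ClosedStep.step_val_congr {T : M.WFormers} {D : ClosedFam (B.wTy T)}
    (d : ClosedStep B T D) {Γ : C} (a : L.Tm Γ) {f f' : (B.wTy T).Tm (M.ext Γ (B.fam a))}
    (hf : f.1 = f'.1) (h : M.Term (D.fam f)) (h' : M.Term (D.fam f')) (hh : h.1 = h'.1) :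
    (d.step a f h).1 = (d.step a f' h').1 := by
  obtain rfl : f = f' := Subtype.ext hf
  obtain rfl : h = h' := Subtype.ext hh
  rfl

/-- The premise of the elimination over the empty context given by a closed one. -/
def ClosedStep.toStep {T : M.WFormers} {D : ClosedFam (B.wTy T)} (d : ClosedStep B T D) :
    T.Step (A := L.ty M.nil) (B := B.openTy M.nil) (D.openTy M.nil) where
  step σ a f h := M.castTm (openTy_consTree σ D a f).symm
    (d.step (M.castTm (L.ty_sub σ) a) (B.closeFam T σ a f)
      (M.sub (M.castCtx (B.arity_eq σ a)) (openTy_consFam σ D a f) h))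
  step_sub {Δ Θ} τ σ a f h := by
    apply Subtype.ext
    refine (d.step_sub τ _ _ _).trans (d.step_val_congr _ ?_ _ _ ?_)
    · exact tmSub_comm ((lift_comp_castCtx _ _ _).trans (castCtx_comp_lift _ _ _).symm) _
    · exact tmSub_comm ((lift_comp_castCtx _ _ _).trans (castCtx_comp_lift _ _ _).symm) _

variable {T : M.WTypes} {D : ClosedFam (B.wTy T.toWFormers)} (d : ClosedStep B T.toWFormers D)

/-- Eliminate once, over one variable of the `W`-type in the empty context; substituting along
`point t` gives the value at any `t`, and naturality is then functoriality of substitution. -/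
theorem exists_recursor : Nonempty (Recursor d) := by
  obtain ⟨r, hr, -⟩ := T.W_elim (D.openTy M.nil) d.toStep
  refine ⟨⟨fun {Γ} t => M.sub ((B.wTy _).point t)
    (D.openTy_sub_of_eq _ _ (M.var_cons _ _ _ _)) r, ?_, ?_⟩⟩
  · intro Γ Δ σ t
    change M.tmSub _ (M.tmSub _ _) = M.tmSub _ _
    rw [← M.tmSub_comp, ClosedTy.comp_point]
  · intro Γ a f
    let σ := M.nilTerminal.from Γ
    -- The computation rule `hr` applies only to data over the empty context, so `a` and `f` are
    -- transported there; `closeFam` undoes the transport of `f`.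
    let a₀ : M.Term (M.tySub σ (L.ty M.nil)) := M.castTm (L.ty_sub σ).symm a
    have e : B.fam a = WFormers.Arity (B.openTy M.nil) σ a₀ := (B.arity_eq σ a₀).symm
    let f₀ : M.Term (M.tySub (M.wk (WFormers.Arity (B.openTy M.nil) σ a₀))
        (T.WAt (B.openTy M.nil) σ)) := M.sub (M.castCtx e)
      (((B.wTy _).ty_sub _).trans ((congrArg (M.tySub _) (B.wAt_eq T.toWFormers σ)).trans
        ((B.wTy _).ty_sub _)).symm) f
    have hf : (B.closeFam T.toWFormers σ a₀ f₀).1 = f.1 :=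
      tmSub_castCtx_symm e (B.arity_eq σ a₀) f.1
    have hc : B.closeFam T.toWFormers σ a₀ f₀ = f := Subtype.ext hf
    have hs : T.consTree σ (T.sup a₀ f₀) = (B.wTy _).point (B.sup T.toWFormers a f) := by
      apply M.hom_ext
      · exact M.nilTerminal.hom_ext _ _
      · refine (M.var_cons _ _ _ _).trans (Eq.trans ?_ (M.var_cons _ _ _ _).symm)
        exact (B.sup_closeFam T.toWFormers σ a₀ f₀).trans
          (congrArg (fun g => (B.sup T.toWFormers a g).1) hc)
    apply Subtype.ext
    refine (congrArg (M.tmSub · r.1) hs.symm).trans ?_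
    refine (congrArg Subtype.val (hr σ a₀ f₀)).trans (d.step_val_congr a hf _ _ ?_)
    change M.tmSub _ (M.tmSub _ r.1) = M.tmSub _ r.1
    rw [← M.tmSub_comp]
    refine congrArg (M.tmSub · r.1) ?_
    refine ((B.wTy T.toWFormers).eq_point _).trans (congrArg _ (Subtype.ext (Eq.trans ?_ hf)))
    exact (M.tmSub_comp _ _ _).trans (congrArg _ (M.var_cons _ _ _ _))

variable {d}

/-- The value of a recursor at the universal variable satisfies the equation that `W_elim` solves
uniquely, and by naturality this value determines all others. -/
theorem Recursor.unique (r r' : Recursor d) {Γ : C} (t : (B.wTy T.toWFormers).Tm Γ) :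
    r.app t = r'.app t := by
  have key : ∀ q : Recursor d, ∀ {Δ : C} (σ : Δ ⟶ M.nil) (a : M.Term (M.tySub σ (L.ty M.nil)))
      (f : M.Term (M.tySub (M.wk (WFormers.Arity (B.openTy M.nil) σ a))
        (T.WAt (B.openTy M.nil) σ))),
      M.sub (T.consTree σ (T.sup a f)) rfl (q.app ((B.wTy T.toWFormers).var M.nil)) =
        d.toStep.step σ a f
          (M.sub (T.consFam σ f) rfl (q.app ((B.wTy T.toWFormers).var M.nil))) := by
    intro q Δ σ a f
    apply Subtype.ext
    refine (q.app_sub _ _).trans ?_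
    have e : (B.wTy T.toWFormers).sub (T.consTree σ (T.sup a f))
        ((B.wTy T.toWFormers).var M.nil) =
        B.sup T.toWFormers (M.castTm (L.ty_sub σ) a) (B.closeFam T.toWFormers σ a f) :=
      Subtype.ext ((M.var_cons _ _ _ _).trans (B.sup_closeFam T.toWFormers σ a f))
    refine (congrArg (fun s => (q.app s).1) e).trans ?_
    rw [q.app_sup]
    refine d.step_val_congr _ rfl _ _ ?_
    refine Eq.symm ((congrArg (M.tmSub _) (q.app_sub _ _)).trans ((q.app_sub _ _).trans ?_))
    refine congrArg (fun s => (q.app s).1) (Subtype.ext ?_)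
    exact congrArg (M.tmSub _) (M.var_cons _ _ _ _)
  have e := (T.W_elim (D.openTy M.nil) d.toStep).unique (key r) (key r')
  apply Subtype.ext
  rw [← (B.wTy T.toWFormers).sub_point_var t, ← r.app_sub, ← r'.app_sub, e]

end NatModel.ClosedFam

/-! ### Non-dependent recursion and injectivity of `sup`. -/

namespace NatModel

/-- A function between closed types, natural in the context. -/
structure ClosedMap {C : Type u} [Category.{v} C] {M : NatModel.{u, v, w, w'} C}
    (X Y : M.ClosedTy) where
  app {Γ : C} (t : X.Tm Γ) : Y.Tm Γ
  app_sub {Γ Δ : C} (σ : Δ ⟶ Γ) (t : X.Tm Γ) : Y.sub σ (app t) = app (X.sub σ t)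

namespace ClosedFam

variable {C : Type u} [Category.{v} C] {M : NatModel.{u, v, w, w'} C} {L : M.ClosedTy}
  {B : ClosedFam L} {T : M.WTypes}

/-- The data of a non-dependent recursion, as a step of the dependent elimination. -/
def constStep (B : ClosedFam L) (T : M.WFormers) (Y : M.ClosedTy)
    (φ : ∀ {Γ : C} (a : L.Tm Γ), Y.Tm (M.ext Γ (B.fam a)) → Y.Tm Γ)
    (hφ : ∀ {Γ Δ : C} (σ : Δ ⟶ Γ) (a : L.Tm Γ) (h : Y.Tm (M.ext Γ (B.fam a))),
      Y.sub σ (φ a h) = φ (L.sub σ a) (Y.sub (B.liftFam σ a) h)) :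
    ClosedStep B T ⟨fun {Γ} _ => Y.ty Γ, fun σ _ => Y.ty_sub σ⟩ where
  step a _ h := φ a h
  step_sub σ a _ h := congrArg Subtype.val (hφ σ a h)

theorem exists_rec (Y : M.ClosedTy)
    (φ : ∀ {Γ : C} (a : L.Tm Γ), Y.Tm (M.ext Γ (B.fam a)) → Y.Tm Γ)
    (hφ : ∀ {Γ Δ : C} (σ : Δ ⟶ Γ) (a : L.Tm Γ) (h : Y.Tm (M.ext Γ (B.fam a))),
      Y.sub σ (φ a h) = φ (L.sub σ a) (Y.sub (B.liftFam σ a) h)) :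
    ∃ F : ClosedMap (B.wTy T.toWFormers) Y,
      ∀ {Γ : C} (a : L.Tm Γ) (f : (B.wTy T.toWFormers).Tm (M.ext Γ (B.fam a))),
        F.app (B.sup _ a f) = φ a (F.app f) := by
  obtain ⟨r⟩ := exists_recursor (constStep B T.toWFormers Y φ hφ)
  exact ⟨⟨r.app, fun σ t => Subtype.ext (r.app_sub σ t)⟩, r.app_sup⟩

theorem rec_unique {Y : M.ClosedTy}
    (φ : ∀ {Γ : C} (a : L.Tm Γ), Y.Tm (M.ext Γ (B.fam a)) → Y.Tm Γ)
    (hφ : ∀ {Γ Δ : C} (σ : Δ ⟶ Γ) (a : L.Tm Γ) (h : Y.Tm (M.ext Γ (B.fam a))),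
      Y.sub σ (φ a h) = φ (L.sub σ a) (Y.sub (B.liftFam σ a) h))
    (F G : ClosedMap (B.wTy T.toWFormers) Y)
    (hF : ∀ {Γ : C} (a : L.Tm Γ) (f : (B.wTy T.toWFormers).Tm (M.ext Γ (B.fam a))),
      F.app (B.sup _ a f) = φ a (F.app f))
    (hG : ∀ {Γ : C} (a : L.Tm Γ) (f : (B.wTy T.toWFormers).Tm (M.ext Γ (B.fam a))),
      G.app (B.sup _ a f) = φ a (G.app f))
    {Γ : C} (t : (B.wTy T.toWFormers).Tm Γ) : F.app t = G.app t :=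
  Recursor.unique (d := constStep B T.toWFormers Y φ hφ)
    ⟨F.app, fun σ t => congrArg Subtype.val (F.app_sub σ t), hF⟩
    ⟨G.app, fun σ t => congrArg Subtype.val (G.app_sub σ t), hG⟩ t

theorem exists_label : ∃ F : ClosedMap (B.wTy T.toWFormers) L,
    ∀ {Γ : C} (a : L.Tm Γ) (f : (B.wTy T.toWFormers).Tm (M.ext Γ (B.fam a))),
      F.app (B.sup _ a f) = a :=
  exists_rec L (fun a _ => a) (fun _ _ _ => rfl)

theorem sup_eq {T : M.WFormers} {Γ : C} {a a' : L.Tm Γ} (e : a = a') (h : B.fam a = B.fam a')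
    {f : (B.wTy T).Tm (M.ext Γ (B.fam a))} {f' : (B.wTy T).Tm (M.ext Γ (B.fam a'))}
    (hf : (B.wTy T).sub (M.castCtx h) f = f') : B.sup T a f = B.sup T a' f' := by
  subst e
  rw [castCtx_rfl, ClosedTy.sub_id] at hf
  rw [hf]

/-- The label is recovered by recursion. The subtrees need dependent elimination, since their index
type depends on the label; abstracted by `lam` they become an element of a type over the tree
itself, and `lam` is injective. -/
theorem sup_injective (P : M.PiTypes) {Γ : C} {a a' : L.Tm Γ}
    {f : (B.wTy T.toWFormers).Tm (M.ext Γ (B.fam a))}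
    {f' : (B.wTy T.toWFormers).Tm (M.ext Γ (B.fam a'))}
    (e : B.sup T.toWFormers a f = B.sup T.toWFormers a' f') :
    (⟨a, f⟩ : Σ a : L.Tm Γ, (B.wTy T.toWFormers).Tm (M.ext Γ (B.fam a))) = ⟨a', f'⟩ := by
  obtain ⟨label, hlabel⟩ := exists_label (B := B) (T := T)
  obtain rfl : a = a' := by rw [← hlabel a f, e, hlabel]
  -- The motive sends a tree to the functions from the arity of its label to trees.
  let D : ClosedFam (B.wTy T.toWFormers) :=
    { fam := fun {Γ} t => P.Pi (B.fam (label.app t)) ((B.wTy T.toWFormers).ty _)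
      fam_sub := fun σ t => P.Pi_tySub σ
        ((B.fam_sub σ _).trans (congrArg B.fam (label.app_sub σ t))) ((B.wTy T.toWFormers).ty_sub _) }
  let d : ClosedStep B T.toWFormers D :=
    { step := fun {Γ} a f _ => M.castTm
        (congrArg (fun x => P.Pi (B.fam x) ((B.wTy T.toWFormers).ty _)) (hlabel a f).symm)
        (P.lam f)
      step_sub := fun σ a f _ =>
        P.lam_tmSub σ (B.fam_sub σ a) ((B.wTy T.toWFormers).ty_sub _) f }
  obtain ⟨r⟩ := exists_recursor d
  have h : (P.lam f).1 = (P.lam f').1 :=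
    (congrArg Subtype.val (r.app_sup a f)).symm.trans
      ((congrArg (fun t => (r.app t).1) e).trans (congrArg Subtype.val (r.app_sup a f')))
  rw [(P.lam_bijective _ _).1 (Subtype.ext h)]

end ClosedFam

/-! ### Products of closed types. -/

namespace ClosedTy

variable {C : Type u} [Category.{v} C] {M : NatModel.{u, v, w, w'} C} (S : M.SigmaTypes)
  (X Y : M.ClosedTy)

/-- The product of two closed types. -/
def prod : M.ClosedTy where
  ty Γ := S.Sig (X.ty Γ) (Y.ty _)
  ty_sub σ := S.Sig_tySub σ (X.ty_sub σ) (Y.ty_sub _)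

variable {X Y}

/-- The pair of two terms of closed types. -/
def pair {Γ : C} (x : X.Tm Γ) (y : Y.Tm Γ) : (prod S X Y).Tm Γ :=
  S.pair x (M.castTm (Y.ty_sub _).symm y)

theorem pair_sub {Γ Δ : C} (σ : Δ ⟶ Γ) (x : X.Tm Γ) (y : Y.Tm Γ) :
    (prod S X Y).sub σ (pair S x y) = pair S (X.sub σ x) (Y.sub σ y) :=
  Subtype.ext (S.pair_tmSub σ (X.ty_sub σ) (Y.ty_sub _) x (M.castTm (Y.ty_sub _).symm y)
    ((congrArg (M.tySub σ) (Y.ty_sub _)).trans ((Y.ty_sub σ).trans (Y.ty_sub _).symm)))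

theorem pair_bijective (Γ : C) : Function.Bijective
    (fun q : X.Tm Γ × Y.Tm Γ => (pair S q.1 q.2 : (prod S X Y).Tm Γ)) := by
  constructor
  · rintro ⟨x, y⟩ ⟨x', y'⟩ e
    have h := (S.pair_bijective (X.ty Γ) (Y.ty _)).1
      (a₁ := ⟨x, M.castTm (Y.ty_sub _).symm y⟩) (a₂ := ⟨x', M.castTm (Y.ty_sub _).symm y'⟩) e
    obtain rfl : x = x' := congrArg Sigma.fst h
    have h₂ := congrArg Subtype.val (eq_of_heq (Sigma.mk.inj h).2)
    obtain rfl : y = y' := Subtype.ext h₂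
    rfl
  · intro p
    obtain ⟨⟨x, y⟩, h⟩ := (S.pair_bijective (X.ty Γ) (Y.ty _)).2 p
    exact ⟨⟨x, M.castTm (Y.ty_sub _) y⟩, h⟩

/-- The first projection. -/
noncomputable def fst {Γ : C} (p : (prod S X Y).Tm Γ) : X.Tm Γ :=
  ((Equiv.ofBijective _ (pair_bijective S Γ)).symm p).1

/-- The second projection. -/
noncomputable def snd {Γ : C} (p : (prod S X Y).Tm Γ) : Y.Tm Γ :=
  ((Equiv.ofBijective _ (pair_bijective S Γ)).symm p).2

theorem pair_fst_snd {Γ : C} (p : (prod S X Y).Tm Γ) : pair S (fst S p) (snd S p) = p :=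
  (Equiv.ofBijective _ (pair_bijective S Γ)).apply_symm_apply p

theorem fst_pair {Γ : C} (x : X.Tm Γ) (y : Y.Tm Γ) : fst S (pair S x y) = x :=
  congrArg Prod.fst ((Equiv.ofBijective _ (pair_bijective S Γ)).symm_apply_apply (x, y))

theorem snd_pair {Γ : C} (x : X.Tm Γ) (y : Y.Tm Γ) : snd S (pair S x y) = y :=
  congrArg Prod.snd ((Equiv.ofBijective _ (pair_bijective S Γ)).symm_apply_apply (x, y))

/-- The projections are inverses of the bijective pairing in each context separately; their
naturality follows from that of pairing. -/
theorem fst_sub {Γ Δ : C} (σ : Δ ⟶ Γ) (p : (prod S X Y).Tm Γ) :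
    X.sub σ (fst S p) = fst S ((prod S X Y).sub σ p) := by
  rw [← fst_pair S (X.sub σ (fst S p)) (Y.sub σ (snd S p)), ← pair_sub, pair_fst_snd]

theorem snd_sub {Γ Δ : C} (σ : Δ ⟶ Γ) (p : (prod S X Y).Tm Γ) :
    Y.sub σ (snd S p) = snd S ((prod S X Y).sub σ p) := by
  rw [← snd_pair S (X.sub σ (fst S p)) (Y.sub σ (snd S p)), ← pair_sub, pair_fst_snd]

end ClosedTy

/-! ### Trees labelled by a value and an arity. -/

namespace Hierarchy

variable {C : Type u} [Category.{v} C] {M : NatModel.{u, v, w, w'} C} {T : M.ExtTT}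
  (U : M.Hierarchy T)

/-- The `i`-th universe as a closed type. -/
abbrev univ (i : ℕ) : M.ClosedTy := ⟨U.U i, U.U_sub i⟩

/-- The labels of the trees: pairs of codes. -/
def labels (i : ℕ) : M.ClosedTy := ClosedTy.prod T.toSigmaTypes (U.univ i) (U.univ i)

/-- The code which a tree with a given label stands for. -/
noncomputable def value {i : ℕ} {Γ : C} (p : (U.labels i).Tm Γ) : U.Code i Γ :=
  ClosedTy.fst T.toSigmaTypes p

/-- The code of the arity of a label. -/
noncomputable def arityCode {i : ℕ} {Γ : C} (p : (U.labels i).Tm Γ) : U.Code i Γ :=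
  ClosedTy.snd T.toSigmaTypes p

/-- The label with a given value and a given arity. -/
def label {i : ℕ} {Γ : C} (d n : U.Code i Γ) : (U.labels i).Tm Γ :=
  ClosedTy.pair T.toSigmaTypes (X := U.univ i) (Y := U.univ i) d n

theorem value_label {i : ℕ} {Γ : C} (d n : U.Code i Γ) : U.value (U.label d n) = d :=
  ClosedTy.fst_pair T.toSigmaTypes (X := U.univ i) (Y := U.univ i) d n

theorem arityCode_label {i : ℕ} {Γ : C} (d n : U.Code i Γ) : U.arityCode (U.label d n) = n :=
  ClosedTy.snd_pair T.toSigmaTypes (X := U.univ i) (Y := U.univ i) d n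

theorem label_value_arityCode {i : ℕ} {Γ : C} (p : (U.labels i).Tm Γ) :
    U.label (U.value p) (U.arityCode p) = p :=
  ClosedTy.pair_fst_snd T.toSigmaTypes (X := U.univ i) (Y := U.univ i) p

theorem value_sub {i : ℕ} {Γ Δ : C} (σ : Δ ⟶ Γ) (p : (U.labels i).Tm Γ) :
    U.codeSub σ (U.value p) = U.value ((U.labels i).sub σ p) :=
  ClosedTy.fst_sub T.toSigmaTypes (X := U.univ i) (Y := U.univ i) σ p

theorem arityCode_sub {i : ℕ} {Γ Δ : C} (σ : Δ ⟶ Γ) (p : (U.labels i).Tm Γ) :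
    U.codeSub σ (U.arityCode p) = U.arityCode ((U.labels i).sub σ p) :=
  ClosedTy.snd_sub T.toSigmaTypes (X := U.univ i) (Y := U.univ i) σ p

theorem label_sub {i : ℕ} {Γ Δ : C} (σ : Δ ⟶ Γ) (d n : U.Code i Γ) :
    (U.labels i).sub σ (U.label d n) = U.label (U.codeSub σ d) (U.codeSub σ n) :=
  ClosedTy.pair_sub T.toSigmaTypes (X := U.univ i) (Y := U.univ i) σ d n

/-- The arities of the labels. -/
noncomputable def arity (i : ℕ) : ClosedFam (U.labels i) where
  fam p := U.El (U.arityCode p)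
  fam_sub σ p := (U.El_sub σ _).trans (congrArg U.El (U.arityCode_sub σ p))

/-- The closed type of trees in which every node carries a code (its value) and the code of the type
by which its subtrees are indexed. -/
noncomputable def tree (i : ℕ) : M.ClosedTy := (U.arity i).wTy T.toWFormers

/-- The tree with value `d` and subtrees `c` indexed by `El n`. -/
noncomputable def node {i : ℕ} {Γ : C} (d n : U.Code i Γ) (c : (U.tree i).Tm (M.ext Γ (U.El n))) :
    (U.tree i).Tm Γ :=
  (U.arity i).sup T.toWFormers (U.label d n)
    ((U.tree i).sub (M.castCtx (congrArg U.El (U.arityCode_label d n).symm)) c)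

/-- The arity `n'` is left free because for most nodes used below (arity `zero`, `two`, `dec a`) the
substituted code has a preferred form. -/
theorem node_sub {i : ℕ} {Γ Δ : C} (σ : Δ ⟶ Γ) (d n : U.Code i Γ)
    (c : (U.tree i).Tm (M.ext Γ (U.El n))) {n' : U.Code i Δ} (hn : U.codeSub σ n = n')
    (h : M.tySub σ (U.El n) = U.El n') :
    (U.tree i).sub σ (U.node d n c) =
      U.node (U.codeSub σ d) n' ((U.tree i).sub (M.lift σ h) c) := by
  subst hn
  refine ((U.arity i).sup_sub T.toWFormers σ _ _).trans (ClosedFam.sup_eq (U.label_sub σ d n)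
    (congrArg _ (U.label_sub σ d n)) (Subtype.ext ?_))
  refine (congrArg (M.tmSub _) (M.tmSub_comp _ _ _).symm).trans (tmSub_comm ?_ _)
  exact ((congrArg (_ ≫ ·) (lift_comp_castCtx _ _ _)).trans
    (castCtx_comp_lift _ _ _)).trans (castCtx_comp_lift _ _ _).symm

theorem sup_eq_node {i : ℕ} {Γ : C} (p : (U.labels i).Tm Γ)
    (f : (U.tree i).Tm (M.ext Γ (U.El (U.arityCode p)))) :
    (U.arity i).sup T.toWFormers p f = U.node (U.value p) (U.arityCode p) f :=
  (ClosedFam.sup_eq (U.label_value_arityCode p) (congrArg _ (U.label_value_arityCode p))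
    (Subtype.ext (tmSub_castCtx_symm _ _ _))).symm

theorem node_injective {i : ℕ} {Γ : C} {d n d' n' : U.Code i Γ}
    {c : (U.tree i).Tm (M.ext Γ (U.El n))} {c' : (U.tree i).Tm (M.ext Γ (U.El n'))}
    (e : U.node d n c = U.node d' n' c') :
    d = d' ∧ (⟨n, c⟩ : Σ n : U.Code i Γ, (U.tree i).Tm (M.ext Γ (U.El n))) = ⟨n', c'⟩ := by
  have h := ClosedFam.sup_injective T.toPiTypes e
  have h₁ : U.label d n = U.label d' n' := congrArg Sigma.fst h
  obtain rfl : d = d' := by rw [← U.value_label d n, h₁, value_label]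
  obtain rfl : n = n' := by rw [← U.arityCode_label d n, h₁, arityCode_label]
  refine ⟨rfl, congrArg _ (Subtype.ext ?_)⟩
  have h₂ := congrArg Subtype.val (eq_of_heq (Sigma.mk.inj h).2)
  rw [← tmSub_castCtx_symm (congrArg U.El (U.arityCode_label d n).symm)
    (congrArg U.El (U.arityCode_label d n)) c.1]
  exact (congrArg (M.tmSub _) h₂).trans (tmSub_castCtx_symm _ _ _)

/-! ### Recursion and uniqueness on trees. -/

section Recursion

variable {U} {i : ℕ} {Y : M.ClosedTy}
  (φ : ∀ {Γ : C} (_ n : U.Code i Γ), Y.Tm (M.ext Γ (U.El n)) → Y.Tm Γ)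

theorem step_congr {Γ : C} {d d' n n' : U.Code i Γ} (hd : d = d') (hn : n = n')
    {h : Y.Tm (M.ext Γ (U.El n))} {h' : Y.Tm (M.ext Γ (U.El n'))}
    (e : Y.sub (M.castCtx (congrArg U.El hn)) h = h') : φ d n h = φ d' n' h' := by
  subst hd
  subst hn
  rw [castCtx_rfl, ClosedTy.sub_id] at e
  rw [e]

theorem step_natural
    (hφ : ∀ {Γ Δ : C} (σ : Δ ⟶ Γ) (d n : U.Code i Γ) (h : Y.Tm (M.ext Γ (U.El n))),
      Y.sub σ (φ d n h) = φ (U.codeSub σ d) (U.codeSub σ n) (Y.sub (U.liftEl σ n) h))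
    {Γ Δ : C} (σ : Δ ⟶ Γ) (p : (U.labels i).Tm Γ)
    (h : Y.Tm (M.ext Γ (U.El (U.arityCode p)))) :
    Y.sub σ (φ (U.value p) (U.arityCode p) h) =
      φ (U.value ((U.labels i).sub σ p)) (U.arityCode ((U.labels i).sub σ p))
        (Y.sub ((U.arity i).liftFam σ p) h) := by
  refine (hφ σ _ _ h).trans (step_congr φ (U.value_sub σ p) (U.arityCode_sub σ p) ?_)
  rw [ClosedTy.sub_sub, castCtx_comp_lift]
  rfl

theorem exists_node_rec
    (hφ : ∀ {Γ Δ : C} (σ : Δ ⟶ Γ) (d n : U.Code i Γ) (h : Y.Tm (M.ext Γ (U.El n))),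
      Y.sub σ (φ d n h) = φ (U.codeSub σ d) (U.codeSub σ n) (Y.sub (U.liftEl σ n) h))
    : ∃ F : ClosedMap (U.tree i) Y,
    ∀ {Γ : C} (d n : U.Code i Γ) (c : (U.tree i).Tm (M.ext Γ (U.El n))),
      F.app (U.node d n c) = φ d n (F.app c) := by
  obtain ⟨F, hF⟩ := ClosedFam.exists_rec (B := U.arity i) (T := T.toWTypes) Y
    (fun p h => φ (U.value p) (U.arityCode p) h) (fun σ p h => step_natural φ hφ σ p h)
  refine ⟨F, fun {Γ} d n c => (hF _ _).trans
    (step_congr φ (U.value_label d n) (U.arityCode_label d n) ?_)⟩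
  refine (congrArg (Y.sub _) (F.app_sub _ c).symm).trans ?_
  exact Subtype.ext (tmSub_castCtx_symm _ _ _)

/-- This takes the place of induction: an equation between natural maps out of trees is proved by
showing that both sides obey one recursion. -/
theorem node_rec_unique
    (hφ : ∀ {Γ Δ : C} (σ : Δ ⟶ Γ) (d n : U.Code i Γ) (h : Y.Tm (M.ext Γ (U.El n))),
      Y.sub σ (φ d n h) = φ (U.codeSub σ d) (U.codeSub σ n) (Y.sub (U.liftEl σ n) h))
    (F G : ClosedMap (U.tree i) Y)
    (hF : ∀ {Γ : C} (d n : U.Code i Γ) (c : (U.tree i).Tm (M.ext Γ (U.El n))),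
      F.app (U.node d n c) = φ d n (F.app c))
    (hG : ∀ {Γ : C} (d n : U.Code i Γ) (c : (U.tree i).Tm (M.ext Γ (U.El n))),
      G.app (U.node d n c) = φ d n (G.app c))
    {Γ : C} (t : (U.tree i).Tm Γ) : F.app t = G.app t :=
  ClosedFam.rec_unique (B := U.arity i) (T := T.toWTypes)
    (fun p h => φ (U.value p) (U.arityCode p) h) (fun σ p h => step_natural φ hφ σ p h) F G
    (fun p f => (congrArg F.app (U.sup_eq_node p f)).trans (hF _ _ _))
    (fun p f => (congrArg G.app (U.sup_eq_node p f)).trans (hG _ _ _)) t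

end Recursion

end Hierarchy

end NatModel

/-! ### Type formers at types only propositionally equal to the expected ones. -/

namespace NatModel

section Congruence

variable {C : Type u} [Category.{v} C] {M : NatModel.{u, v, w, w'} C}

theorem SigmaTypes.Sig_congr (S : M.SigmaTypes) {Γ : C} {A A' : M.Ty Γ} {B : M.Ty (M.ext Γ A)}
    {B' : M.Ty (M.ext Γ A')} (h : A = A') (hB : M.tySub (M.castCtx h) B = B') :
    S.Sig A B = S.Sig A' B' := by
  rw [← S.Sig_tySub (𝟙 Γ) _ hB, M.tySub_id]

theorem WFormers.W_congr (T : M.WFormers) {Γ : C} {A A' : M.Ty Γ} {B : M.Ty (M.ext Γ A)}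
    {B' : M.Ty (M.ext Γ A')} (h : A = A') (hB : M.tySub (M.castCtx h) B = B') :
    T.W A B = T.W A' B' := by
  rw [← T.W_tySub (𝟙 Γ) _ hB, M.tySub_id]

theorem inst_castCtx {Γ : C} {A A' : M.Ty Γ} (h : A = A') (a : M.Term A) (a' : M.Term A')
    (e : a.1 = a'.1) : M.inst a' ≫ M.castCtx h = M.inst a := by
  subst h
  rw [castCtx_rfl, Category.comp_id, show a = a' from Subtype.ext e]

theorem FiniteTypes.existsUnique_of_eq_Zero (F : M.FiniteTypes) {Γ : C} {E : M.Ty Γ}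
    (hE : E = F.Zero Γ) (D : M.Ty (M.ext Γ E)) : ∃! _r : M.Term D, True := by
  subst hE
  exact F.zero_elim D

theorem FiniteTypes.existsUnique_of_eq_Two (F : M.FiniteTypes) {Γ : C} {E : M.Ty Γ}
    (hE : E = F.Two Γ) (Y : M.ClosedTy) (s t : Y.Tm Γ) : ∃! r : Y.Tm (M.ext Γ E),
      Y.sub (M.inst (M.castTm hE.symm (F.tt Γ))) r = s ∧
      Y.sub (M.inst (M.castTm hE.symm (F.ff Γ))) r = t := by
  subst hE
  obtain ⟨r, ⟨h₁, h₂⟩, hr⟩ := F.two_elim (Y.ty (M.ext Γ (F.Two Γ)))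
    (M.castTm (Y.ty_sub _).symm s) (M.castTm (Y.ty_sub _).symm t)
  refine ⟨r, ⟨?_, ?_⟩, fun r' h => hr r' ⟨?_, ?_⟩⟩
  · exact Subtype.ext (congrArg Subtype.val h₁ :)
  · exact Subtype.ext (congrArg Subtype.val h₂ :)
  · exact Subtype.ext (congrArg Subtype.val h.1 :)
  · exact Subtype.ext (congrArg Subtype.val h.2 :)

end Congruence

/-! ### Root values, coercions, and trees that record their arguments. -/

namespace Hierarchy

variable {C : Type u} [Category.{v} C] {M : NatModel.{u, v, w, w'} C} {T : M.ExtTT}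
  (U : M.Hierarchy T)

theorem exists_dec (i : ℕ) : ∃ F : ClosedMap (U.tree i) (U.univ i),
    ∀ {Γ : C} (d n : U.Code i Γ) (c : (U.tree i).Tm (M.ext Γ (U.El n))),
      F.app (U.node d n c) = d :=
  exists_node_rec (Y := U.univ i) (fun d _ _ => d) (fun _ _ _ _ => rfl)

/-- The value at the root of a tree. -/
noncomputable def dec {i : ℕ} {Γ : C} (t : (U.tree i).Tm Γ) : U.Code i Γ :=
  (U.exists_dec i).choose.app t

theorem dec_sub {i : ℕ} {Γ Δ : C} (σ : Δ ⟶ Γ) (t : (U.tree i).Tm Γ) :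
    U.codeSub σ (U.dec t) = U.dec ((U.tree i).sub σ t) :=
  (U.exists_dec i).choose.app_sub σ t

theorem dec_node {i : ℕ} {Γ : C} (d n : U.Code i Γ) (c : (U.tree i).Tm (M.ext Γ (U.El n))) :
    U.dec (U.node d n c) = d :=
  (U.exists_dec i).choose_spec d n c

theorem El_dec_sub {i : ℕ} {Γ Δ : C} (σ : Δ ⟶ Γ) (t : (U.tree i).Tm Γ) :
    M.tySub σ (U.El (U.dec t)) = U.El (U.dec ((U.tree i).sub σ t)) :=
  (U.El_sub σ _).trans (congrArg U.El (U.dec_sub σ t))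

theorem cum_step_sub {i j : ℕ} (h : i ≤ j) {Γ Δ : C} (σ : Δ ⟶ Γ) (d n : U.Code i Γ)
    (c : (U.tree j).Tm (M.ext Γ (U.El n))) :
    (U.tree j).sub σ (U.node (U.cum h d) (U.cum h n)
      ((U.tree j).sub (M.castCtx (U.El_cum h n)) c)) =
    U.node (U.cum h (U.codeSub σ d)) (U.cum h (U.codeSub σ n))
      ((U.tree j).sub (M.castCtx (U.El_cum h _)) ((U.tree j).sub (U.liftEl σ n) c)) := by
  rw [U.node_sub σ _ _ _ (U.cum_sub h σ n) (by rw [← U.El_cum, U.El_sub, ← U.El_cum]),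
    U.cum_sub h σ d, ClosedTy.sub_sub, ClosedTy.sub_sub, lift_comp_castCtx, castCtx_comp_lift]

theorem exists_treeCum {i j : ℕ} (h : i ≤ j) : ∃ F : ClosedMap (U.tree i) (U.tree j),
    ∀ {Γ : C} (d n : U.Code i Γ) (c : (U.tree i).Tm (M.ext Γ (U.El n))),
      F.app (U.node d n c) = U.node (U.cum h d) (U.cum h n)
        ((U.tree j).sub (M.castCtx (U.El_cum h n)) (F.app c)) :=
  exists_node_rec (Y := U.tree j) (fun d n c => U.node (U.cum h d) (U.cum h n)
    ((U.tree j).sub (M.castCtx (U.El_cum h n)) c)) (U.cum_step_sub h)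

/-- The coercion of trees, which applies the coercion of codes at every node. -/
noncomputable def treeCum {i j : ℕ} (h : i ≤ j) {Γ : C} (t : (U.tree i).Tm Γ) : (U.tree j).Tm Γ :=
  (U.exists_treeCum h).choose.app t

theorem treeCum_sub {i j : ℕ} (h : i ≤ j) {Γ Δ : C} (σ : Δ ⟶ Γ) (t : (U.tree i).Tm Γ) :
    (U.tree j).sub σ (U.treeCum h t) = U.treeCum h ((U.tree i).sub σ t) :=
  (U.exists_treeCum h).choose.app_sub σ t

theorem treeCum_node {i j : ℕ} (h : i ≤ j) {Γ : C} (d n : U.Code i Γ)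
    (c : (U.tree i).Tm (M.ext Γ (U.El n))) :
    U.treeCum h (U.node d n c) = U.node (U.cum h d) (U.cum h n)
      ((U.tree j).sub (M.castCtx (U.El_cum h n)) (U.treeCum h c)) :=
  (U.exists_treeCum h).choose_spec d n c

/-- The coercion of trees as a map of closed types. -/
noncomputable def treeCumMap {i j : ℕ} (h : i ≤ j) : ClosedMap (U.tree i) (U.tree j) :=
  ⟨U.treeCum h, U.treeCum_sub h⟩

theorem node_congr {i : ℕ} {Γ : C} {d d' n n' : U.Code i Γ} (hd : d = d') (hn : n = n')
    (h : U.El n = U.El n') {c : (U.tree i).Tm (M.ext Γ (U.El n))}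
    {c' : (U.tree i).Tm (M.ext Γ (U.El n'))} (e : (U.tree i).sub (M.castCtx h) c = c') :
    U.node d n c = U.node d' n' c' :=
  step_congr (U.node) hd hn e

/-- By functoriality of `cum`, the identity map satisfies the recursion defining the coercion. -/
theorem treeCum_refl {i : ℕ} {Γ : C} (t : (U.tree i).Tm Γ) : U.treeCum le_rfl t = t := by
  refine node_rec_unique (Y := U.tree i) (fun d n c => U.node (U.cum le_rfl d) (U.cum le_rfl n)
    ((U.tree i).sub (M.castCtx (U.El_cum le_rfl n)) c)) (U.cum_step_sub le_rfl)
    (U.treeCumMap le_rfl) ⟨fun t => t, fun _ _ => rfl⟩ (U.treeCum_node le_rfl) ?_ t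
  intro Γ d n c
  exact U.node_congr (U.cum_refl d).symm (U.cum_refl n).symm _ rfl

theorem treeCum_trans {i j k : ℕ} (h : i ≤ j) (h' : j ≤ k) {Γ : C} (t : (U.tree i).Tm Γ) :
    U.treeCum h' (U.treeCum h t) = U.treeCum (h.trans h') t := by
  refine node_rec_unique (Y := U.tree k) (fun d n c => U.node (U.cum (h.trans h') d)
    (U.cum (h.trans h') n) ((U.tree k).sub (M.castCtx (U.El_cum (h.trans h') n)) c))
    (U.cum_step_sub (h.trans h')) ⟨fun t => U.treeCum h' (U.treeCum h t), fun σ t => ?_⟩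
    (U.treeCumMap (h.trans h')) ?_ (U.treeCum_node (h.trans h')) t
  · rw [treeCum_sub, treeCum_sub]
  · intro Γ d n c
    change U.treeCum h' (U.treeCum h (U.node d n c)) = _
    rw [treeCum_node, treeCum_node]
    refine U.node_congr (U.cum_trans h h' d) (U.cum_trans h h' n)
      (congrArg _ (U.cum_trans h h' n)) ?_
    rw [← treeCum_sub, ClosedTy.sub_sub, ClosedTy.sub_sub, castCtx_comp, castCtx_comp]

/-- Both sides send a node of value `d` to `cum h d`, ignoring the subtrees. -/
theorem dec_treeCum {i j : ℕ} (h : i ≤ j) {Γ : C} (t : (U.tree i).Tm Γ) :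
    U.dec (U.treeCum h t) = U.cum h (U.dec t) := by
  refine node_rec_unique (Y := U.univ j) (fun d _ _ => U.cum h d)
    (fun σ d _ _ => U.cum_sub h σ d)
    ⟨fun t => U.dec (U.treeCum h t), fun σ t => ?_⟩
    ⟨fun t => U.cum h (U.dec t), fun σ t => ?_⟩ ?_ ?_ t
  · exact (U.dec_sub σ _).trans (congrArg U.dec (U.treeCum_sub h σ t))
  · exact (U.cum_sub h σ _).trans (congrArg (U.cum h) (U.dec_sub σ t))
  · intro Γ d n c
    exact (congrArg U.dec (U.treeCum_node h d n c)).trans (U.dec_node _ _ _)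
  · intro Γ d n c
    exact congrArg (U.cum h) (U.dec_node d n c)

theorem El_dec_treeCum {i j : ℕ} (h : i ≤ j) {Γ : C} (t : (U.tree i).Tm Γ) :
    U.El (U.dec t) = U.El (U.dec (U.treeCum h t)) := by
  rw [dec_treeCum, ← U.El_cum]

/-- The empty family of trees. -/
noncomputable def emptyFam (i : ℕ) (Γ : C) : (U.tree i).Tm (M.ext Γ (U.El (U.zero i Γ))) :=
  (T.existsUnique_of_eq_Zero (U.El_zero i Γ) ((U.tree i).ty _)).choose

/-- Uniqueness of elimination from the empty type; it makes childless trees stable under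
substitution and coercion. -/
theorem emptyFam_ext {i j : ℕ} {Γ : C} (c c' : (U.tree i).Tm (M.ext Γ (U.El (U.zero j Γ)))) :
    c = c' :=
  (T.existsUnique_of_eq_Zero (U.El_zero j Γ) ((U.tree i).ty _)).unique trivial trivial

/-- The tree without subtrees whose value is a given code. -/
noncomputable def up {i : ℕ} {Γ : C} (d : U.Code i Γ) : (U.tree i).Tm Γ :=
  U.node d (U.zero i Γ) (U.emptyFam i Γ)

theorem up_sub {i : ℕ} {Γ Δ : C} (σ : Δ ⟶ Γ) (d : U.Code i Γ) :
    (U.tree i).sub σ (U.up d) = U.up (U.codeSub σ d) := by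
  rw [up, U.node_sub σ _ _ _ (U.zero_sub i σ) 
    ((U.El_sub σ _).trans (congrArg U.El (U.zero_sub i σ)))]
  exact congrArg _ (U.emptyFam_ext _ _)

theorem dec_up {i : ℕ} {Γ : C} (d : U.Code i Γ) : U.dec (U.up d) = d :=
  U.dec_node _ _ _

theorem treeCum_up {i j : ℕ} (h : i ≤ j) {Γ : C} (d : U.Code i Γ) :
    U.treeCum h (U.up d) = U.up (U.cum h d) := by
  rw [up, treeCum_node]
  exact U.node_congr rfl (U.cum_zero h Γ) (congrArg _ (U.cum_zero h Γ)) (U.emptyFam_ext _ _)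

/-- The family of trees indexed by the booleans with given values. -/
noncomputable def boolFam {i : ℕ} {Γ : C} (s t : (U.tree i).Tm Γ) :
    (U.tree i).Tm (M.ext Γ (U.El (U.two i Γ))) :=
  (T.existsUnique_of_eq_Two (U.El_two i Γ) (U.tree i) s t).choose

/-- The element `true` of the decoded type of booleans. -/
def elTrue (i : ℕ) (Γ : C) : M.Term (U.El (U.two i Γ)) := M.castTm (U.El_two i Γ).symm (T.tt Γ)

/-- The element `false` of the decoded type of booleans. -/
def elFalse (i : ℕ) (Γ : C) : M.Term (U.El (U.two i Γ)) := M.castTm (U.El_two i Γ).symm (T.ff Γ)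

theorem elTrue_sub {i : ℕ} {Γ Δ : C} (σ : Δ ⟶ Γ)
    (h : M.tySub σ (U.El (U.two i Γ)) = U.El (U.two i Δ)) :
    M.sub σ h (U.elTrue i Γ) = U.elTrue i Δ := by
  have e := congrArg Subtype.val (T.tt_sub σ)
  exact Subtype.ext e

theorem elFalse_sub {i : ℕ} {Γ Δ : C} (σ : Δ ⟶ Γ)
    (h : M.tySub σ (U.El (U.two i Γ)) = U.El (U.two i Δ)) :
    M.sub σ h (U.elFalse i Γ) = U.elFalse i Δ := by
  have e := congrArg Subtype.val (T.ff_sub σ)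
  exact Subtype.ext e

theorem boolFam_true {i : ℕ} {Γ : C} (s t : (U.tree i).Tm Γ) :
    (U.tree i).sub (M.inst (U.elTrue i Γ)) (U.boolFam s t) = s :=
  (T.existsUnique_of_eq_Two (U.El_two i Γ) (U.tree i) s t).choose_spec.1.1

theorem boolFam_false {i : ℕ} {Γ : C} (s t : (U.tree i).Tm Γ) :
    (U.tree i).sub (M.inst (U.elFalse i Γ)) (U.boolFam s t) = t :=
  (T.existsUnique_of_eq_Two (U.El_two i Γ) (U.tree i) s t).choose_spec.1.2

/-- The uniqueness clause of boolean elimination, by which compatibilities of two-branch trees are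
checked at `true` and `false` alone. -/
theorem eq_boolFam {i : ℕ} {Γ : C} {s t : (U.tree i).Tm Γ}
    {r : (U.tree i).Tm (M.ext Γ (U.El (U.two i Γ)))}
    (h₁ : (U.tree i).sub (M.inst (U.elTrue i Γ)) r = s)
    (h₂ : (U.tree i).sub (M.inst (U.elFalse i Γ)) r = t) : r = U.boolFam s t :=
  (T.existsUnique_of_eq_Two (U.El_two i Γ) (U.tree i) s t).choose_spec.2 r ⟨h₁, h₂⟩

/-- The tree with value `d` and two subtrees. -/
noncomputable def pairTree {i : ℕ} {Γ : C} (d : U.Code i Γ) (s t : (U.tree i).Tm Γ) :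
    (U.tree i).Tm Γ :=
  U.node d (U.two i Γ) (U.boolFam s t)

theorem pairTree_sub {i : ℕ} {Γ Δ : C} (σ : Δ ⟶ Γ) (d : U.Code i Γ) (s t : (U.tree i).Tm Γ) :
    (U.tree i).sub σ (U.pairTree d s t) =
      U.pairTree (U.codeSub σ d) ((U.tree i).sub σ s) ((U.tree i).sub σ t) := by
  have h : M.tySub σ (U.El (U.two i Γ)) = U.El (U.two i Δ) :=
    (U.El_sub σ _).trans (congrArg U.El (U.two_sub i σ))
  rw [pairTree, U.node_sub σ _ _ _ (U.two_sub i σ) h]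
  refine congrArg _ (U.eq_boolFam ?_ ?_)
  · rw [ClosedTy.sub_sub, ← U.elTrue_sub σ h, ← M.inst_comp, ← ClosedTy.sub_sub, boolFam_true]
  · rw [ClosedTy.sub_sub, ← U.elFalse_sub σ h, ← M.inst_comp, ← ClosedTy.sub_sub, boolFam_false]

theorem dec_pairTree {i : ℕ} {Γ : C} (d : U.Code i Γ) (s t : (U.tree i).Tm Γ) :
    U.dec (U.pairTree d s t) = d :=
  U.dec_node _ _ _

theorem pairTree_injective {i : ℕ} {Γ : C} {d d' : U.Code i Γ} {s t s' t' : (U.tree i).Tm Γ}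
    (e : U.pairTree d s t = U.pairTree d' s' t') : s = s' ∧ t = t' := by
  have h := eq_of_heq (Sigma.mk.inj (U.node_injective e).2).2
  constructor
  · rw [← U.boolFam_true s t, h, boolFam_true]
  · rw [← U.boolFam_false s t, h, boolFam_false]

theorem treeCum_pairTree {i j : ℕ} (h : i ≤ j) {Γ : C} (d : U.Code i Γ)
    (s t : (U.tree i).Tm Γ) :
    U.treeCum h (U.pairTree d s t) =
      U.pairTree (U.cum h d) (U.treeCum h s) (U.treeCum h t) := by
  rw [pairTree, treeCum_node]
  refine U.node_congr rfl (U.cum_two h Γ) (congrArg _ (U.cum_two h Γ)) (U.eq_boolFam ?_ ?_)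
  · rw [ClosedTy.sub_sub, ClosedTy.sub_sub, Category.assoc, castCtx_comp,
      inst_castCtx _ (U.elTrue i Γ) (U.elTrue j Γ) rfl, treeCum_sub, boolFam_true]
  · rw [ClosedTy.sub_sub, ClosedTy.sub_sub, Category.assoc, castCtx_comp,
      inst_castCtx _ (U.elFalse i Γ) (U.elFalse j Γ) rfl, treeCum_sub, boolFam_false]

/-- The tree with value `d` which records a tree `a` and a family of trees over its decoding. -/
noncomputable def famTree {i : ℕ} {Γ : C} (d : U.Code i Γ) (a : (U.tree i).Tm Γ)
    (b : (U.tree i).Tm (M.ext Γ (U.El (U.dec a)))) : (U.tree i).Tm Γ :=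
  -- Only the arity of the inner node matters, as it lets `b` be a family of subtrees. Its value is
  -- filler, chosen to be stable and to commute with coercions.
  U.pairTree d a (U.node (U.dec a) (U.dec a) b)

theorem famTree_sub {i : ℕ} {Γ Δ : C} (σ : Δ ⟶ Γ) (d : U.Code i Γ) (a : (U.tree i).Tm Γ)
    (b : (U.tree i).Tm (M.ext Γ (U.El (U.dec a)))) :
    (U.tree i).sub σ (U.famTree d a b) = U.famTree (U.codeSub σ d) ((U.tree i).sub σ a)
      ((U.tree i).sub (M.lift σ (U.El_dec_sub σ a)) b) := by
  rw [famTree, pairTree_sub, U.node_sub σ _ _ _ (U.dec_sub σ a) (U.El_dec_sub σ a), U.dec_sub σ a]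
  rfl

theorem dec_famTree {i : ℕ} {Γ : C} (d : U.Code i Γ) (a : (U.tree i).Tm Γ)
    (b : (U.tree i).Tm (M.ext Γ (U.El (U.dec a)))) : U.dec (U.famTree d a b) = d :=
  U.dec_pairTree _ _ _

theorem famTree_injective {i : ℕ} {Γ : C} {d d' : U.Code i Γ} {a a' : (U.tree i).Tm Γ}
    {b : (U.tree i).Tm (M.ext Γ (U.El (U.dec a)))}
    {b' : (U.tree i).Tm (M.ext Γ (U.El (U.dec a')))}
    (e : U.famTree d a b = U.famTree d' a' b') :
    (⟨a, b⟩ : Σ a : (U.tree i).Tm Γ, (U.tree i).Tm (M.ext Γ (U.El (U.dec a)))) = ⟨a', b'⟩ := by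
  obtain ⟨rfl, h⟩ := U.pairTree_injective e
  rw [eq_of_heq (Sigma.mk.inj (U.node_injective h).2).2]

theorem treeCum_famTree {i j : ℕ} (h : i ≤ j) {Γ : C} (d : U.Code i Γ) (a : (U.tree i).Tm Γ)
    (b : (U.tree i).Tm (M.ext Γ (U.El (U.dec a)))) :
    U.treeCum h (U.famTree d a b) = U.famTree (U.cum h d) (U.treeCum h a)
      (U.treeCum h ((U.tree i).sub (M.castCtx (U.El_dec_treeCum h a)) b)) := by
  rw [famTree, treeCum_pairTree, treeCum_node]
  refine congrArg _ (U.node_congr (U.dec_treeCum h a).symm (U.dec_treeCum h a).symm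
    (congrArg _ (U.dec_treeCum h a).symm) ?_)
  rw [ClosedTy.sub_sub, castCtx_comp, treeCum_sub]

end Hierarchy

end NatModel

/-! ### Injective codes for the type formers. -/

namespace NatModel.Hierarchy

variable {C : Type u} [Category.{v} C] {M : NatModel.{u, v, w, w'} C} {T : M.ExtTT}
  (U : M.Hierarchy T)

theorem binder_congr {α : Type*} {i j : ℕ} {Γ : C}
    (φ : ∀ a : U.Code i Γ, U.Code j (M.ext Γ (U.El a)) → α) {a a' : U.Code i Γ} (e : a = a')
    (h : U.El a = U.El a') {b : U.Code j (M.ext Γ (U.El a))} {b' : U.Code j (M.ext Γ (U.El a'))}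
    (hb : U.codeSub (M.castCtx h) b = b') : φ a b = φ a' b' := by
  subst e
  rw [castCtx_rfl] at hb
  rw [← hb, show U.codeSub (𝟙 _) b = b from Subtype.ext (M.tmSub_id b.1)]

theorem eq_congr {i : ℕ} {Γ : C} {a a' : U.Code i Γ} (e : a = a') {s t : M.Term (U.El a)}
    {s' t' : M.Term (U.El a')} (hs : s.1 = s'.1) (ht : t.1 = t'.1) :
    U.eq a s t = U.eq a' s' t' := by
  subst e
  rw [show s = s' from Subtype.ext hs, show t = t' from Subtype.ext ht]

/-- The last variable of a context extended by a decoded type. -/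
def elVar {i : ℕ} {Γ : C} (a : U.Code i Γ) : M.Term (U.El (U.codeSub (M.wk (U.El a)) a)) :=
  ⟨M.var _, (M.tp_var _).trans (U.El_sub _ a)⟩

/-- The code of the equality with a given element, in the context extended by a variable. -/
def eqCode {i : ℕ} {Γ : C} (a : U.Code i Γ) (s : M.Term (U.El a)) :
    U.Code i (M.ext Γ (U.El a)) :=
  U.eq (U.codeSub (M.wk _) a) (U.elVar a) (M.sub (M.wk _) (U.El_sub _ a) s)

theorem eqCode_sub {i : ℕ} {Γ Δ : C} (σ : Δ ⟶ Γ) (a : U.Code i Γ) (s : M.Term (U.El a))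
    {a' : U.Code i Δ} (e : U.codeSub σ a = a') (h : M.tySub σ (U.El a) = U.El a') :
    U.codeSub (M.lift σ h) (U.eqCode a s) = U.eqCode a' (M.sub σ h s) := by
  subst e
  refine (U.eq_sub _ _ _ _).trans (U.eq_congr (Subtype.ext ?_) ?_ ?_)
  · exact tmSub_comm (M.lift_wk σ h) _
  · exact tmSub_lift_var σ h
  · exact tmSub_comm (M.lift_wk σ h) _

theorem cum_eqCode {i j : ℕ} (h : i ≤ j) {Γ : C} (a : U.Code i Γ) (s : M.Term (U.El a))
    {a' : U.Code j Γ} (e : U.cum h a = a') (h' : U.El a = U.El a') :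
    U.cum h (U.codeSub (M.castCtx h') (U.eqCode a s)) = U.eqCode a' (M.castTm h' s) := by
  subst e
  have hw {t : M.Tm Γ} : M.tmSub (M.castCtx h') (M.tmSub (M.wk _) t) = M.tmSub (M.wk _) t :=
    (M.tmSub_comp _ _ _).symm.trans (congrArg (M.tmSub · t) (castCtx_wk h'))
  rw [eqCode, U.eq_sub, U.cum_eq]
  refine U.eq_congr ?_ (tmSub_castCtx_var h') hw
  refine Eq.trans (congrArg (U.cum h) (Subtype.ext ?_)) (U.cum_sub h _ a).symm
  exact hw

/-- Instantiating the variable at `s` and decoding turns the equation into an equality of the types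
`s = s` and `s = s'`. Reflexivity inhabits the former, hence the latter, and reflection concludes.
No injectivity of the codes of `U` is needed. -/
theorem eqCode_injective {i : ℕ} {Γ : C} {a : U.Code i Γ} {s s' : M.Term (U.El a)}
    (e : U.eqCode a s = U.eqCode a s') : s = s' := by
  have hE (t : M.Term (U.El a)) := (congrArg U.El (U.eq_sub (M.inst s) _ (U.elVar a)
    (M.sub (M.wk _) (U.El_sub _ a) t))).trans (U.El_eq _ _ _)
  have h := (hE s).symm.trans ((congrArg (fun c => U.El (U.codeSub (M.inst s) c)) e).trans (hE s'))
  have hw (t : M.Tm Γ) : M.tmSub (M.inst s) (M.tmSub (M.wk _) t) = t := by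
    rw [← M.tmSub_comp, inst_wk, M.tmSub_id]
  have key : ∀ {A : M.Ty Γ} (x y y' : M.Term A), x.1 = y.1 → T.EqTy x y = T.EqTy x y' →
      x.1 = y'.1 := by
    intro A x y y' hxy hE
    obtain rfl : x = y := Subtype.ext hxy
    exact congrArg Subtype.val (T.reflection (M.castTm hE (T.refl x)))
  have h' := key _ _ _ ((tmSub_inst_var s).trans (hw s.1).symm) h
  exact Subtype.ext ((tmSub_inst_var s).symm.trans (h'.trans (hw s'.1)))

section Binder

/-- A code-forming operation for a binary type former which binds a variable, stable under
substitution and commuting with the coercions. -/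
structure Binder where
  op {i : ℕ} {Γ : C} (a : U.Code i Γ) (b : U.Code i (M.ext Γ (U.El a))) : U.Code i Γ
  op_sub {i : ℕ} {Γ Δ : C} (σ : Δ ⟶ Γ) (a : U.Code i Γ) (b : U.Code i (M.ext Γ (U.El a))) :
    U.codeSub σ (op a b) = op (U.codeSub σ a) (U.codeSub (U.liftEl σ a) b)
  cum_op {i j : ℕ} (h : i ≤ j) {Γ : C} (a : U.Code i Γ) (b : U.Code i (M.ext Γ (U.El a))) :
    U.cum h (op a b) = op (U.cum h a) (U.cum h (U.codeSub (M.castCtx (U.El_cum h a)) b))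

variable {U} (φ : U.Binder)

/-- The code-forming operation on trees which records its arguments. -/
noncomputable def Binder.tree {i : ℕ} {Γ : C} (a : (U.tree i).Tm Γ)
    (b : (U.tree i).Tm (M.ext Γ (U.El (U.dec a)))) : (U.tree i).Tm Γ :=
  U.famTree (φ.op (U.dec a) (U.dec b)) a b

theorem Binder.tree_sub {i : ℕ} {Γ Δ : C} (σ : Δ ⟶ Γ) (a : (U.tree i).Tm Γ)
    (b : (U.tree i).Tm (M.ext Γ (U.El (U.dec a)))) :
    (U.tree i).sub σ (φ.tree a b) =
      φ.tree ((U.tree i).sub σ a) ((U.tree i).sub (M.lift σ (U.El_dec_sub σ a)) b) := by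
  refine (U.famTree_sub σ _ a b).trans (congrArg (U.famTree · _ _) ?_)
  refine (φ.op_sub σ _ _).trans (U.binder_congr _ (U.dec_sub σ a)
    (congrArg _ (U.dec_sub σ a)) ?_)
  refine Eq.trans (Subtype.ext ?_) (U.dec_sub _ b)
  exact (M.tmSub_comp _ _ _).symm.trans (congrArg (M.tmSub · _) (castCtx_comp_lift _ _ _))

theorem Binder.dec_tree {i : ℕ} {Γ : C} (a : (U.tree i).Tm Γ)
    (b : (U.tree i).Tm (M.ext Γ (U.El (U.dec a)))) :
    U.dec (φ.tree a b) = φ.op (U.dec a) (U.dec b) :=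
  U.dec_famTree _ _ _

theorem Binder.treeCum_tree {i j : ℕ} (h : i ≤ j) {Γ : C} (a : (U.tree i).Tm Γ)
    (b : (U.tree i).Tm (M.ext Γ (U.El (U.dec a)))) :
    U.treeCum h (φ.tree a b) = φ.tree (U.treeCum h a)
      (U.treeCum h ((U.tree i).sub (M.castCtx (U.El_dec_treeCum h a)) b)) := by
  refine (U.treeCum_famTree h _ a b).trans (congrArg (U.famTree · _ _) ?_)
  refine (φ.cum_op h _ _).trans (U.binder_congr _ (U.dec_treeCum h a).symm
    (congrArg _ (U.dec_treeCum h a).symm) ?_)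
  refine (U.cum_sub h _ _).trans (Eq.trans (congrArg (U.cum h) (Eq.trans (Subtype.ext ?_)
    (U.dec_sub _ b))) (U.dec_treeCum h _).symm)
  exact (M.tmSub_comp _ _ _).symm.trans (congrArg (M.tmSub · _) (castCtx_comp _ _))

theorem Binder.tree_injective (i : ℕ) (Γ : C) : Function.Injective
    (fun x : (Σ a : (U.tree i).Tm Γ, (U.tree i).Tm (M.ext Γ (U.El (U.dec a)))) =>
      φ.tree x.1 x.2) :=
  fun _ _ e => U.famTree_injective e

end Binder

/-- The binder of dependent products. -/
def piBinder : U.Binder := ⟨U.pi, U.pi_sub, U.cum_pi⟩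

/-- The binder of dependent sums. -/
def sgBinder : U.Binder := ⟨U.sg, U.sg_sub, U.cum_sg⟩

/-- The binder of `W`-types. -/
def wtBinder : U.Binder := ⟨U.wt, U.wt_sub, U.cum_wt⟩

/-- The family of trees which records two elements of a decoded type. -/
noncomputable def elemsFam {i : ℕ} {Γ : C} (a : U.Code i Γ) (s t : M.Term (U.El a)) :
    (U.tree i).Tm (M.ext Γ (U.El a)) :=
  U.pairTree (U.zero i _) (U.up (U.eqCode a s)) (U.up (U.eqCode a t))

theorem elemsFam_injective {i : ℕ} {Γ : C} {a : U.Code i Γ} {s t s' t' : M.Term (U.El a)}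
    (e : U.elemsFam a s t = U.elemsFam a s' t') : s = s' ∧ t = t' := by
  have h := U.pairTree_injective e
  have hs := congrArg U.dec h.1
  have ht := congrArg U.dec h.2
  rw [dec_up, dec_up] at hs ht
  exact ⟨U.eqCode_injective hs, U.eqCode_injective ht⟩

/-- The code of an equality type, as a tree which records its arguments. -/
noncomputable def eqTree {i : ℕ} {Γ : C} (a : (U.tree i).Tm Γ) (s t : M.Term (U.El (U.dec a))) :
    (U.tree i).Tm Γ :=
  U.famTree (U.eq (U.dec a) s t) a (U.elemsFam (U.dec a) s t)

theorem dec_eqTree {i : ℕ} {Γ : C} (a : (U.tree i).Tm Γ) (s t : M.Term (U.El (U.dec a))) :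
    U.dec (U.eqTree a s t) = U.eq (U.dec a) s t :=
  U.dec_famTree _ _ _

theorem eqTree_sub {i : ℕ} {Γ Δ : C} (σ : Δ ⟶ Γ) (a : (U.tree i).Tm Γ)
    (s t : M.Term (U.El (U.dec a))) :
    (U.tree i).sub σ (U.eqTree a s t) = U.eqTree ((U.tree i).sub σ a)
      (M.sub σ (U.El_dec_sub σ a) s) (M.sub σ (U.El_dec_sub σ a) t) := by
  rw [eqTree, famTree_sub, eqTree, elemsFam, pairTree_sub, up_sub, up_sub,
    U.eqCode_sub σ _ _ (U.dec_sub σ a), U.eqCode_sub σ _ _ (U.dec_sub σ a), U.zero_sub]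
  refine congrArg (U.famTree · _ _) ((U.eq_sub σ _ s t).trans ?_)
  exact U.eq_congr (U.dec_sub σ a) rfl rfl

theorem treeCum_eqTree {i j : ℕ} (h : i ≤ j) {Γ : C} (a : (U.tree i).Tm Γ)
    (s t : M.Term (U.El (U.dec a))) :
    U.treeCum h (U.eqTree a s t) = U.eqTree (U.treeCum h a)
      (M.castTm (U.El_dec_treeCum h a) s) (M.castTm (U.El_dec_treeCum h a) t) := by
  rw [eqTree, treeCum_famTree, eqTree, elemsFam, pairTree_sub, up_sub, up_sub, treeCum_pairTree,
    treeCum_up, treeCum_up, U.cum_eqCode h _ _ (U.dec_treeCum h a).symm,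
    U.cum_eqCode h _ _ (U.dec_treeCum h a).symm, U.zero_sub, U.cum_zero]
  refine congrArg (U.famTree · _ _) ((U.cum_eq h _ s t).trans ?_)
  exact U.eq_congr (U.dec_treeCum h a).symm rfl rfl

theorem eqTree_injective (i : ℕ) (Γ : C) : Function.Injective
    (fun x : (Σ a : (U.tree i).Tm Γ, M.Term (U.El (U.dec a)) × M.Term (U.El (U.dec a))) =>
      U.eqTree x.1 x.2.1 x.2.2) := by
  rintro ⟨a, s, t⟩ ⟨a', s', t'⟩ e
  have h := U.famTree_injective e
  obtain rfl : a = a' := congrArg Sigma.fst h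
  obtain ⟨rfl, rfl⟩ := U.elemsFam_injective (eq_of_heq (Sigma.mk.inj h).2)
  rfl

/-! ### Codes for the universes of trees. -/

/-- The code of the type of labels in the next universe. -/
def labelsCode (i : ℕ) (Γ : C) : U.Code (i + 1) Γ :=
  U.sg (U.uni (Nat.lt_succ_self i) Γ) (U.uni (Nat.lt_succ_self i) _)

theorem El_labelsCode (i : ℕ) (Γ : C) : U.El (U.labelsCode i Γ) = (U.labels i).ty Γ :=
  (U.El_sg _ _).trans (T.Sig_congr (U.El_uni _ Γ)
    ((congrArg _ (U.El_uni _ _)).trans (U.U_sub i _)))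

theorem labelsCode_sub (i : ℕ) {Γ Δ : C} (σ : Δ ⟶ Γ) :
    U.codeSub σ (U.labelsCode i Γ) = U.labelsCode i Δ :=
  (U.sg_sub σ _ _).trans (U.binder_congr _ (U.uni_sub _ σ) (congrArg _ (U.uni_sub _ σ))
    ((congrArg _ (U.uni_sub _ _)).trans (U.uni_sub _ _)))

/-- The code of the type of trees in the next universe. -/
noncomputable def treeCode (i : ℕ) (Γ : C) : U.Code (i + 1) Γ :=
  -- Arities are codes at level `i`; coercing them to level `i + 1` leaves their decodings
  -- unchanged.
  U.wt (U.labelsCode i Γ) (U.codeSub (M.castCtx (U.El_labelsCode i Γ).symm)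
    (U.cum (Nat.le_succ i) (U.arityCode ((U.labels i).var Γ))))

theorem El_treeCode (i : ℕ) (Γ : C) : U.El (U.treeCode i Γ) = (U.tree i).ty Γ := by
  refine (U.El_wt _ _).trans (T.W_congr (U.El_labelsCode i Γ) ?_)
  rw [← U.El_sub, ← M.tySub_comp, castCtx_comp, castCtx_rfl, M.tySub_id, ← U.El_cum]
  rfl

theorem treeCode_sub (i : ℕ) {Γ Δ : C} (σ : Δ ⟶ Γ) :
    U.codeSub σ (U.treeCode i Γ) = U.treeCode i Δ := by
  refine (U.wt_sub σ _ _).trans (U.binder_congr _ (U.labelsCode_sub i σ)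
    (congrArg _ (U.labelsCode_sub i σ)) ?_)
  have e : U.codeSub (M.lift σ ((U.labels i).ty_sub σ))
      (U.cum (Nat.le_succ i) (U.arityCode ((U.labels i).var Γ))) =
      U.cum (Nat.le_succ i) (U.arityCode ((U.labels i).var Δ)) := by
    rw [U.cum_sub, arityCode_sub, ClosedTy.sub_lift_var]
  rw [← e]
  refine Subtype.ext ((congrArg (M.tmSub _) (M.tmSub_comp _ _ _).symm).trans (tmSub_comm ?_ _))
  exact ((congrArg (_ ≫ ·) (lift_comp_castCtx _ _ _)).trans
    (castCtx_comp_lift _ _ _)).trans (castCtx_comp_lift _ _ _).symm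

/-! ### The hierarchy of trees and its comparison with `U`. -/

/-- The hierarchy of the universes of trees. -/
noncomputable def trees : M.Hierarchy T where
  U i := (U.tree i).ty
  U_sub i := (U.tree i).ty_sub
  El a := U.El (U.dec a)
  El_sub σ a := U.El_dec_sub σ a
  cum h _ a := U.treeCum h a
  cum_sub h _ _ σ a := U.treeCum_sub h σ a
  cum_refl a := U.treeCum_refl a
  cum_trans h h' _ a := U.treeCum_trans h h' a
  El_cum h _ a := U.El_dec_treeCum h a
  -- A strict inequality `i < j` is by definition `i + 1 ≤ j`, so `h` itself coerces the code from
  -- level `i + 1`.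
  uni {i _} h Γ := U.up (U.cum h (U.treeCode i Γ))
  uni_sub {i _} h _ _ σ := (U.up_sub σ _).trans
    (congrArg U.up ((U.cum_sub h σ _).trans (congrArg (U.cum h) (U.treeCode_sub i σ))))
  El_uni {i _} h Γ := (congrArg U.El (U.dec_up _)).trans
    ((U.El_cum h _).symm.trans (U.El_treeCode i Γ))
  cum_uni h h' _ := (U.treeCum_up h' _).trans (congrArg U.up (U.cum_trans h h' _))
  pi a b := U.piBinder.tree a b
  pi_sub σ a b := U.piBinder.tree_sub σ a b
  El_pi a b := (congrArg U.El (U.piBinder.dec_tree a b)).trans (U.El_pi _ _)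
  cum_pi h _ a b := U.piBinder.treeCum_tree h a b
  sg a b := U.sgBinder.tree a b
  sg_sub σ a b := U.sgBinder.tree_sub σ a b
  El_sg a b := (congrArg U.El (U.sgBinder.dec_tree a b)).trans (U.El_sg _ _)
  cum_sg h _ a b := U.sgBinder.treeCum_tree h a b
  wt a b := U.wtBinder.tree a b
  wt_sub σ a b := U.wtBinder.tree_sub σ a b
  El_wt a b := (congrArg U.El (U.wtBinder.dec_tree a b)).trans (U.El_wt _ _)
  cum_wt h _ a b := U.wtBinder.treeCum_tree h a b
  eq a s t := U.eqTree a s t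
  eq_sub σ a s t := U.eqTree_sub σ a s t
  El_eq a s t := (congrArg U.El (U.dec_eqTree a s t)).trans (U.El_eq _ _ _)
  cum_eq h _ a s t := U.treeCum_eqTree h a s t
  zero i Γ := U.up (U.zero i Γ)
  zero_sub i _ _ σ := (U.up_sub σ _).trans (congrArg U.up (U.zero_sub i σ))
  El_zero i Γ := (congrArg U.El (U.dec_up _)).trans (U.El_zero i Γ)
  cum_zero h Γ := (U.treeCum_up h _).trans (congrArg U.up (U.cum_zero h Γ))
  one i Γ := U.up (U.one i Γ)
  one_sub i _ _ σ := (U.up_sub σ _).trans (congrArg U.up (U.one_sub i σ))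
  El_one i Γ := (congrArg U.El (U.dec_up _)).trans (U.El_one i Γ)
  cum_one h Γ := (U.treeCum_up h _).trans (congrArg U.up (U.cum_one h Γ))
  two i Γ := U.up (U.two i Γ)
  two_sub i _ _ σ := (U.up_sub σ _).trans (congrArg U.up (U.two_sub i σ))
  El_two i Γ := (congrArg U.El (U.dec_up _)).trans (U.El_two i Γ)
  cum_two h Γ := (U.treeCum_up h _).trans (congrArg U.up (U.cum_two h Γ))

theorem trees_injectiveCodes : U.trees.InjectiveCodes where
  pi_injective i Γ := U.piBinder.tree_injective i Γ
  sg_injective i Γ := U.sgBinder.tree_injective i Γ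
  wt_injective i Γ := U.wtBinder.tree_injective i Γ
  eq_injective i Γ := U.eqTree_injective i Γ

theorem codeSub_castCtx_rfl {i : ℕ} {Γ : C} {A : M.Ty Γ} (h : A = A)
    (b : U.Code i (M.ext Γ A)) : U.codeSub (M.castCtx h) b = b :=
  Subtype.ext ((congrArg (M.tmSub · b.1) (castCtx_rfl h)).trans (M.tmSub_id b.1))

/-- The hierarchy of trees replaces the given one. -/
noncomputable def treesReplacement : Replacement U U.trees where
  up a := U.up a
  up_sub σ a := U.up_sub σ a
  dec a := U.dec a
  dec_sub σ a := U.dec_sub σ a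
  dec_up a := U.dec_up a
  El_dec _ := rfl
  cum_up h _ a := U.treeCum_up h a
  dec_cum h _ a := U.dec_treeCum h a
  dec_pi a b := (U.piBinder.dec_tree a b).trans
    (congrArg (U.pi _) (U.codeSub_castCtx_rfl rfl _).symm)
  dec_sg a b := (U.sgBinder.dec_tree a b).trans
    (congrArg (U.sg _) (U.codeSub_castCtx_rfl rfl _).symm)
  dec_wt a b := (U.wtBinder.dec_tree a b).trans
    (congrArg (U.wt _) (U.codeSub_castCtx_rfl rfl _).symm)
  dec_eq a s t := U.dec_eqTree a s t
  dec_zero _ _ := U.dec_up _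
  dec_one _ _ := U.dec_up _
  dec_two _ _ := U.dec_up _

theorem Replacement.isSmall_iff {U V : M.Hierarchy T} (R : Replacement U V) (i : ℕ) {Γ : C} (A : M.Ty Γ) :
    V.IsSmall i A ↔ U.IsSmall i A := by
  constructor
  · rintro ⟨a, rfl⟩
    exact ⟨R.dec a, (R.El_dec a).symm⟩
  · rintro ⟨a, rfl⟩
    exact ⟨R.up a, by rw [R.El_dec, R.dec_up]⟩

end NatModel.Hierarchy

/-! ### Generic families. -/

namespace NatModel.Universes

variable {C : Type u} [Category.{v} C] {M : NatModel.{u, v, w, w'} C}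

/-- If the universal code of one universe has the same decoding as a code in another one, then the
pullbacks of the generic family of the former are pullbacks of the generic family of the latter. -/
theorem classified_le {U V : M.Universes} {i : ℕ} (c : U.Code i (M.ext M.nil (V.U i M.nil)))
    (hc : U.El c = V.El (V.univCode i)) : V.classified i ≤ U.classified i := by
  intro X Y f
  rintro ⟨g, y, h⟩
  let X' : M.ClosedTy := ⟨U.U i, U.U_sub i⟩
  have e : M.tySub (X'.point c) (U.El (U.univCode i)) = V.El (V.univCode i) := by
    rw [U.El_sub, ← hc]
    exact congrArg U.El (X'.sub_point_var c)
  exact ⟨_, _, h.paste_horiz (isPullback_lift _ e)⟩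

end NatModel.Universes

theorem mainTheorem3 {C : Type u} [Category.{v} C] (M : NatModel.{u, v, w, w'} C)
    (T : M.ExtTT) (U : M.Hierarchy T) :
    ∃ V : M.Hierarchy T,
      V.InjectiveCodes ∧
      (∀ i : ℕ, V.classified i = U.classified i) ∧
      (∀ (i : ℕ) (Γ : C) (A : M.Ty Γ), V.IsSmall i A ↔ U.IsSmall i A) ∧
      Nonempty (NatModel.Hierarchy.Replacement U V) := by
  have R := U.treesReplacement
  refine ⟨U.trees, U.trees_injectiveCodes, fun i => le_antisymm ?_ ?_,
    fun i Γ A => R.isSmall_iff i A, ⟨R⟩⟩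
  -- Each universal code is carried to the other universe by `dec` or `up`, neither of which changes
  -- the decoded type.
  · exact NatModel.Universes.classified_le (R.dec (U.trees.univCode i)) (R.El_dec _).symm
  · exact NatModel.Universes.classified_le (R.up (U.univCode i)) (by rw [R.El_dec, R.dec_up])
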